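/- Let $d\ge 1$ be an integer. The random $d$-process on $n$ vertices starts with the empty graph; at every step two distinct vertices are chosen uniformly at random, and an edge is added between them if and only if they are nonadjacent and both have degree at most $d-1$. It ends when no such pair is left. Let $G_m$ be the graph after $m$ edges have been added, let $V_{m,k}$ be the number of vertices of degree $k$ in $G_m$, and let $\mathbf V_m=[V_{m,0},\dots,V_{m,d}]'$. Let $\gamma=[\gamma_0,\dots,\gamma_d]'$ be the solution on $[0,d/2)$, in the region $\gamma_d<1$, of $$\gamma_k'(t)=\frac{2\,\delta_{k>0}\,\gamma_{k-1}(t)-2\,\delta_{k<d}\,\gamma_k(t)}{1-\gamma_d(t)},\qquad 0\le k\le d,$$ where $\delta_{k>0}$ and $\delta_{k<d}$ are $1$ if the indicated inequality holds and $0$ otherwise, with $\gamma_0(0)=1$ and $\gamma_k(0)=0$ for $1\le k\le d$ (such a solution exists). Then there is a continuous function $\Sigma$ from $[0,d/2)$ to the positive semidefinite $(d+1)\times(d+1)$ real matrices with the following property. Let $\delta>0$, and let $m_\delta=m_\delta(n)$ be the smallest nonnegative integer for which $\gamma_d(m_\delta/n)>1-\delta$ (it exists and is less than $nd/2$ for all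 sufficiently large $n$). Then, as $n\to\infty$, $$\frac{\mathbf V_m-n\gamma(m/n)}{\sqrt n}\ \xrightarrow{d}\ \mathcal N\bigl(0,\Sigma(m/n)\bigr)\qquad\text{for } 0\le m\le m_\delta,$$ in the sense that for every bounded continuous $f:\mathbb R^{d+1}\to\mathbb R$, $$\max_{0\le m\le m_\delta(n)}\left|\,\mathbb E\, f\!\left(\frac{\mathbf V_m-n\gamma(m/n)}{\sqrt n}\right)-\mathbb E\, f\bigl(N_{m/n}\bigr)\right|\to 0,$$ where $N_t$ has the distribution $\mathcal N(0,\Sigma(t))$. -/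

import Mathlib

open MeasureTheory ProbabilityTheory Filter Topology
open scoped BoundedContinuousFunction

noncomputable section

namespace DProc

/-! ### The random `d`-process -/

open scoped Classical in
/-- The (ordered) pairs of distinct nonadjacent vertices of `G`, both of degree at most `d - 1`:
the pairs which the `d`-process accepts as a new edge when the current graph is `G`. -/
def eligible (d : ℕ) {n : ℕ} (G : SimpleGraph (Fin n)) : Finset (Fin n × Fin n) :=
  Finset.univ.filter fun p =>
    p.1 ≠ p.2 ∧ ¬ G.Adj p.1 p.2 ∧ G.degree p.1 < d ∧ G.degree p.2 < d

open scoped Classical in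
/-- The law of the graph after one more edge has been added to `G`. Repeatedly proposing a uniformly
random pair of distinct vertices until an eligible pair is proposed produces a uniformly random
eligible pair. If there is no eligible pair, the process has ended and stays at `G`. -/
def step (d : ℕ) {n : ℕ} (G : SimpleGraph (Fin n)) : PMF (SimpleGraph (Fin n)) :=
  if h : (eligible d G).Nonempty then
    (PMF.uniformOfFinset (eligible d G) h).map fun p => G ⊔ SimpleGraph.edge p.1 p.2
  else PMF.pure G

/-- The law of `G_m`, the graph after `m` edges have been added, starting from the empty graph
on `n` vertices. -/
def graphLaw (d n : ℕ) : ℕ → PMF (SimpleGraph (Fin n))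
  | 0 => PMF.pure ⊥
  | m + 1 => (graphLaw d n m).bind (step d)

open scoped Classical in
/-- The vector of the numbers of vertices of degree `0, …, d` in `G`. -/
def degreeCounts (d : ℕ) {n : ℕ} (G : SimpleGraph (Fin n)) : EuclideanSpace ℝ (Fin (d + 1)) :=
  WithLp.toLp 2 fun k => ((Finset.univ.filter fun v => G.degree v = (k : ℕ)).card : ℝ)

/-! ### The differential equation -/

/-- The right-hand side
`f_k(z) = (2 δ_{k>0} z_{k-1} - 2 δ_{k<d} z_k) / (1 - z_d)` of the differential equation. -/
def drift (d : ℕ) (z : EuclideanSpace ℝ (Fin (d + 1))) (k : Fin (d + 1)) : ℝ :=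
  (2 * (if 0 < k then z (k - 1) else 0) - 2 * (if k < Fin.last d then z k else 0))
    / (1 - z (Fin.last d))

/-- `γ = (γ_0, …, γ_d)` solves the differential equation `γ' = f(γ)` on `[0, d/2)`, inside the region
`z_d < 1` and with `γ_0(0) = 1` and `γ_k(0) = 0` for `k > 0`. -/
structure IsSolution (d : ℕ) (γ : ℝ → EuclideanSpace ℝ (Fin (d + 1))) : Prop where
  initial : ∀ k, γ 0 k = if k = 0 then 1 else 0
  lt_one : ∀ t ∈ Set.Ico (0 : ℝ) (d / 2), γ t (Fin.last d) < 1
  deriv : ∀ t ∈ Set.Ico (0 : ℝ) (d / 2), ∀ k,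
    HasDerivWithinAt (fun s => γ s k) (drift d (γ t) k) (Set.Ico (0 : ℝ) (d / 2)) t

/-! ### The normalized degree counts -/

/-- The law of `(V_m - n γ(m/n)) / √n`, where `V_m` is the vector of degree counts of `G_m`. -/
def normalizedLaw (d : ℕ) (γ : ℝ → EuclideanSpace ℝ (Fin (d + 1))) (n m : ℕ) :
    Measure (EuclideanSpace ℝ (Fin (d + 1))) :=
  ((graphLaw d n m).map fun G =>
    (√(n : ℝ))⁻¹ • (degreeCounts d G - (n : ℝ) • γ ((m : ℝ) / n))).toMeasure

/-- `m_δ`: the smallest `m` for which `γ_d(m/n) > 1 - δ`. (Such an `m < nd/2` exists for all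
sufficiently large `n`.) -/
def mDelta (d : ℕ) (γ : ℝ → EuclideanSpace ℝ (Fin (d + 1))) (δ : ℝ) (n : ℕ) : ℕ :=
  sInf {m : ℕ | 1 - δ < γ ((m : ℝ) / n) (Fin.last d)}

end DProc

end

noncomputable section

namespace DProc

/-! ### The generator of the degree dynamics, acting on test functions -/

/-! Write `D a` for the forward difference of a test vector `a`, and `u = n - V_d` for the number of
unsaturated vertices. Up to time `T < d/2` the degree sum forces `u ≥ (1 - 2T/d) n`, so an accepted
edge joins two nearly independent uniform unsaturated vertices. Hence `a · V` changes on average by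
`2 (D a · V) / u + O(1/n)`.

Let `s' = 2 / (1 - γ_d)` and transport a test vector by `a(t) = exp(-s(t) D) η`. The motion of `a`
cancels the drift along `γ`, so `a(t) · γ(t) = η 0`. The drift of `Y = a(t) · (V - nγ(t))` then
comes only from replacing `u` by `n (1 - γ_d)`, which costs `(D a · V) |V - nγ| / n²`, plus
`O(1/n)`. In general this is linear feedback of order `|V - nγ| / n`. It becomes quadratic, `|V -
nγ|² / n²`, when `(D η) 0 = 0`, because then `D a · γ` vanishes for all times. Since `E |V - nγ|² =
O(n)` by a discrete Gronwall argument (`exists_second_moment_le`), such a `Y` is almost a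
martingale. Its increments are bounded and their conditional variance is close to `quadRate`, the
derivative of `quadVar`; so `E exp(iY/√n) · exp(quadVar/2)` stays within `O(n^{-1/2})` of `1`
(`exists_charFun_bound`).

The restriction on `η` costs nothing. After `m` edges the degrees sum to exactly `2m`, so the degree
vector is orthogonal to `V - nγ`, and a multiple of it can be subtracted from any `θ` to achieve `D
b · γ(t) = 0` (`corrected`). The limiting variance is the variance of `b` under the probability
vector `γ(t)`, which gives `covMatrix`.

Lévy's theorem and compactness of `[0, T]` make the convergence uniform in `m ≤ Tn`
(`eventually_abs_integral_sub_lt`), and `1 - γ_d(t) ≤ d - 2t` puts `m_δ` in such a range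
(`exists_mDelta_le`). A solution exists because, in the clock `s`, `γ` is the law of a Poisson
variable of mean `s` capped at `d` (`exists_isSolution`). -/

/-- The degree class after one more edge: `k + 1`, truncated at `d`. -/
def next {d : ℕ} (k : Fin (d + 1)) : Fin (d + 1) := ⟨min (k + 1) d, by omega⟩

@[simp] lemma next_last (d : ℕ) : next (Fin.last d) = Fin.last d := by
  ext; simp [next]

@[simp] lemma next_castSucc {d : ℕ} (j : Fin d) : next j.castSucc = j.succ := by
  ext; simp [next]

/-- The forward difference `(D a)_k = a_{k+1} - a_k`, with `(D a)_d = 0`. -/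
def shiftDiff (d : ℕ) : (Fin (d + 1) → ℝ) →L[ℝ] (Fin (d + 1) → ℝ) :=
  LinearMap.toContinuousLinearMap
    { toFun := fun a k => a (next k) - a k
      map_add' := fun a b => by ext k; simp; ring
      map_smul' := fun c a => by ext k; simp; ring }

@[simp] lemma shiftDiff_apply {d : ℕ} (a : Fin (d + 1) → ℝ) (k : Fin (d + 1)) :
    shiftDiff d a k = a (next k) - a k := rfl

lemma shiftDiff_last {d : ℕ} (a : Fin (d + 1) → ℝ) : shiftDiff d a (Fin.last d) = 0 := by simp

lemma norm_shiftDiff_le {d : ℕ} (a : Fin (d + 1) → ℝ) : ‖shiftDiff d a‖ ≤ 2 * ‖a‖ := by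
  refine (pi_norm_le_iff_of_nonneg (by positivity)).2 fun k => ?_
  rw [shiftDiff_apply]
  calc ‖a (next k) - a k‖ ≤ ‖a (next k)‖ + ‖a k‖ := norm_sub_le _ _
    _ ≤ 2 * ‖a‖ := by linarith [norm_le_pi_norm a (next k), norm_le_pi_norm a k]

/-- Summation by parts: up to the factor `2 / (1 - z_d)`, the drift is the adjoint of the forward
difference. The wrapped value of `k - 1` at `k = 0` is masked by the indicator. -/
lemma sum_mul_drift {d : ℕ} (a : Fin (d + 1) → ℝ) (z : EuclideanSpace ℝ (Fin (d + 1))) :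
    ∑ k, a k * drift d z k = 2 / (1 - z (Fin.last d)) * (shiftDiff d a ⬝ᵥ z.ofLp) := by
  have key : ∑ k, a k * (2 * (if 0 < k then z (k - 1) else 0)
      - 2 * (if k < Fin.last d then z k else 0)) = 2 * (shiftDiff d a ⬝ᵥ z.ofLp) := by
    have h1 : ∑ k, a k * (if 0 < k then z (k - 1) else 0)
        = ∑ j : Fin d, a j.succ * z j.castSucc := by
      rw [Fin.sum_univ_succ]
      simp only [lt_self_iff_false, if_false, mul_zero, zero_add, Fin.succ_pos, if_true]
      refine Finset.sum_congr rfl fun j _ => ?_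
      have h : j.succ - 1 = j.castSucc := by
        ext
        rw [Fin.coe_sub_one]
        simp
      rw [h]
    have h2 : ∑ k, a k * (if k < Fin.last d then z k else 0)
        = ∑ j : Fin d, a j.castSucc * z j.castSucc := by
      rw [Fin.sum_univ_castSucc]
      simp [Fin.castSucc_lt_last]
    have h3 : shiftDiff d a ⬝ᵥ z.ofLp
        = ∑ j : Fin d, (a j.succ - a j.castSucc) * z j.castSucc := by
      rw [dotProduct, Fin.sum_univ_castSucc]
      simp
    rw [h3, show ∑ k, a k * (2 * (if 0 < k then z (k - 1) else 0)
      - 2 * (if k < Fin.last d then z k else 0))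
      = 2 * ∑ k, a k * (if 0 < k then z (k - 1) else 0)
        - 2 * ∑ k, a k * (if k < Fin.last d then z k else 0) by
      rw [Finset.mul_sum, Finset.mul_sum, ← Finset.sum_sub_distrib]
      exact Finset.sum_congr rfl fun k _ => by ring, h1, h2, ← mul_sub, ← Finset.sum_sub_distrib]
    congr 1
    exact Finset.sum_congr rfl fun j _ => by ring
  rw [div_mul_eq_mul_div, ← key, Finset.sum_div]
  exact Finset.sum_congr rfl fun k _ => by rw [drift, mul_div_assoc]

/-- The one-parameter group generated by `shiftDiff`. -/
def flow (d : ℕ) (r : ℝ) : (Fin (d + 1) → ℝ) →L[ℝ] (Fin (d + 1) → ℝ) :=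
  NormedSpace.exp (r • shiftDiff d)

@[simp] lemma flow_zero_apply {d : ℕ} (a : Fin (d + 1) → ℝ) : flow d 0 a = a := by
  simp [flow, NormedSpace.exp_zero]

lemma flow_flow {d : ℕ} (r r' : ℝ) (a : Fin (d + 1) → ℝ) :
    flow d r (flow d r' a) = flow d (r + r') a := by
  let _ : NormedAlgebra ℚ ((Fin (d + 1) → ℝ) →L[ℝ] (Fin (d + 1) → ℝ)) :=
    NormedAlgebra.restrictScalars ℚ ℝ _
  have h : Commute (r • shiftDiff d) (r' • shiftDiff d) :=
    ((Commute.refl (shiftDiff d)).smul_left r).smul_right r'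
  rw [flow, flow, flow, add_smul, NormedSpace.exp_add_of_commute h]
  rfl

lemma flow_shiftDiff {d : ℕ} (r : ℝ) (a : Fin (d + 1) → ℝ) :
    flow d r (shiftDiff d a) = shiftDiff d (flow d r a) := by
  have h : Commute (shiftDiff d) (flow d r) :=
    ((Commute.refl (shiftDiff d)).smul_right r).exp_right
  exact (congrArg (fun f => f a) h.eq).symm

lemma hasDerivAt_flow (d : ℕ) (r : ℝ) :
    HasDerivAt (flow d) ((shiftDiff d) ∘L (flow d r)) r :=
  hasDerivAt_exp_smul_const' (𝕂 := ℝ) (shiftDiff d) r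

lemma continuous_flow (d : ℕ) : Continuous (flow d) :=
  continuous_iff_continuousAt.2 fun r => (hasDerivAt_flow d r).continuousAt

/-! ### Properties of the solution -/

section Solution

variable {d : ℕ} {γ : ℝ → EuclideanSpace ℝ (Fin (d + 1))}

lemma IsSolution.hasDerivWithinAt_dotProduct (hγ : IsSolution d γ) (a : Fin (d + 1) → ℝ) {t : ℝ}
    (ht : t ∈ Set.Ico (0 : ℝ) (d / 2)) :
    HasDerivWithinAt (fun s => a ⬝ᵥ (γ s).ofLp)
      (2 / (1 - γ t (Fin.last d)) * (shiftDiff d a ⬝ᵥ (γ t).ofLp)) (Set.Ico (0 : ℝ) (d / 2)) t := by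
  rw [← sum_mul_drift]
  exact HasDerivWithinAt.fun_sum fun k _ => (hγ.deriv t ht k).const_mul (a k)

lemma IsSolution.dotProduct_zero (hγ : IsSolution d γ) (a : Fin (d + 1) → ℝ) :
    a ⬝ᵥ (γ 0).ofLp = a 0 := by
  simp [dotProduct, hγ.initial]

lemma eq_of_hasDerivWithinAt_const {f : ℝ → ℝ} {T c : ℝ}
    (hf : ∀ t ∈ Set.Ico 0 T, HasDerivWithinAt f c (Set.Ico 0 T) t) :
    ∀ t ∈ Set.Ico 0 T, f t = f 0 + c * t := by
  intro t ht
  have h0 : (0 : ℝ) ∈ Set.Ico 0 T := ⟨le_rfl, ht.1.trans_lt ht.2⟩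
  have := Convex.norm_image_sub_le_of_norm_hasDerivWithin_le (f := fun t => f t - c * t)
    (f' := fun _ => 0) (s := Set.Ico 0 T) (C := 0)
    (fun x hx => by simpa using (hf x hx).fun_sub ((hasDerivWithinAt_id x _).const_mul c))
    (by simp) (convex_Ico 0 T) h0 ht
  simp only [zero_mul, norm_le_zero_iff] at this
  linarith

lemma IsSolution.sum_eq_one (hγ : IsSolution d γ) {t : ℝ} (ht : t ∈ Set.Ico (0 : ℝ) (d / 2)) :
    ∑ k, γ t k = 1 := by
  have h := eq_of_hasDerivWithinAt_const (f := fun s => (fun _ => (1 : ℝ)) ⬝ᵥ (γ s).ofLp) (c := 0)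
    (T := d / 2) (fun t ht => by
      convert hγ.hasDerivWithinAt_dotProduct (fun _ => (1 : ℝ)) ht using 1
      simp [dotProduct]) t ht
  simp only [hγ.dotProduct_zero] at h
  simpa [dotProduct] using h

lemma shiftDiff_val_dotProduct (z : Fin (d + 1) → ℝ) :
    shiftDiff d (fun k => (k : ℝ)) ⬝ᵥ z = ∑ k, z k - z (Fin.last d) := by
  rw [dotProduct, Fin.sum_univ_castSucc, Fin.sum_univ_castSucc]
  simp

lemma IsSolution.sum_val_mul (hγ : IsSolution d γ) {t : ℝ} (ht : t ∈ Set.Ico (0 : ℝ) (d / 2)) :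
    ∑ k : Fin (d + 1), (k : ℝ) * γ t k = 2 * t := by
  have h := eq_of_hasDerivWithinAt_const (f := fun s => (fun k : Fin (d + 1) => (k : ℝ)) ⬝ᵥ (γ s).ofLp)
    (c := 2) (T := d / 2) (fun t ht => by
      convert hγ.hasDerivWithinAt_dotProduct (fun k : Fin (d + 1) => (k : ℝ)) ht using 1
      rw [shiftDiff_val_dotProduct, hγ.sum_eq_one ht, div_mul_cancel₀]
      linarith [hγ.lt_one t ht]) t ht
  simp only [hγ.dotProduct_zero] at h
  simpa [dotProduct] using h

/-- Barrier argument: where `-γ_k` meets the positive barrier `ε (1 + s) / (1 + t)`, `γ_k` is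
negative, so `-γ_k` does not increase while the barrier does. At time `t` the barrier equals `ε`. -/
lemma IsSolution.nonneg_of_drift (hγ : IsSolution d γ) (k : Fin (d + 1))
    (hk : ∀ t ∈ Set.Ico (0 : ℝ) (d / 2), γ t k < 0 → 0 ≤ drift d (γ t) k) {t : ℝ}
    (ht : t ∈ Set.Ico (0 : ℝ) (d / 2)) : 0 ≤ γ t k := by
  refine le_of_forall_pos_le_add fun ε hε => ?_
  have ht1 : 0 < 1 + t := by linarith [ht.1]
  have hsub : Set.Icc 0 t ⊆ Set.Ico (0 : ℝ) (d / 2) := fun x hx => ⟨hx.1, hx.2.trans_lt ht.2⟩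
  have hε' : 0 < ε / (1 + t) := by positivity
  have := image_le_of_deriv_right_lt_deriv_boundary' (f := fun s => -γ s k)
    (f' := fun s => -drift d (γ s) k) (a := 0) (b := t)
    (B := fun s => ε / (1 + t) * (1 + s)) (B' := fun _ => ε / (1 + t))
    (fun s hs => ((hγ.deriv s (hsub hs) k).mono hsub).neg.continuousWithinAt)
    (fun s hs => ((hγ.deriv s (hsub (Set.Ico_subset_Icc_self hs)) k).mono_of_mem_nhdsWithin
      (by
        filter_upwards [Ico_mem_nhdsGE (show s < d / 2 from hs.2.trans ht.2)] with x hx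
        exact ⟨hs.1.trans hx.1, hx.2⟩)).fun_neg)
    (by
      simp only [hγ.initial]
      split_ifs <;> (simp; linarith))
    (by fun_prop)
    (fun s _ => by
      simpa using (((hasDerivAt_id s).const_add 1).const_mul (ε / (1 + t))).hasDerivWithinAt)
    (fun s hs hfs => by
      have hs1 : 0 < 1 + s := by linarith [hs.1]
      have hB : 0 < ε / (1 + t) * (1 + s) := by positivity
      have := hk s (hsub (Set.Ico_subset_Icc_self hs)) (by simp only at hfs; linarith)
      linarith)
    (Set.right_mem_Icc.2 ht.1)
  simp only [div_mul_cancel₀ ε ht1.ne'] at this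
  linarith

/-- Induction on the degree: the inflow into a class comes from the class below, and the outflow of
a negative class pushes it upwards. -/
lemma IsSolution.nonneg (hγ : IsSolution d γ) {t : ℝ} (ht : t ∈ Set.Ico (0 : ℝ) (d / 2))
    (k : Fin (d + 1)) : 0 ≤ γ t k := by
  obtain ⟨k, hk⟩ := k
  induction k generalizing t with
  | zero =>
    refine hγ.nonneg_of_drift _ (fun t ht h => ?_) ht
    have := hγ.lt_one t ht
    refine div_nonneg ?_ (by linarith)
    split_ifs <;> simp_all <;> linarith
  | succ k ih =>
    refine hγ.nonneg_of_drift _ (fun t ht h => ?_) ht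
    have := hγ.lt_one t ht
    refine div_nonneg ?_ (by linarith)
    have hpred : (⟨k + 1, hk⟩ - 1 : Fin (d + 1)) = ⟨k, by omega⟩ := by
      ext
      rw [Fin.coe_sub_one]
      simp [Fin.ext_iff]
    have := ih ht (by omega)
    rw [hpred]
    split_ifs <;> linarith

/-- Class `d` alone contributes `d γ_d` to the mean degree `2t`. This yields `1 - γ_d ≥ 1 - 2T/d` on
`[0, T]`, the constant that also bounds the proportion of unsaturated vertices. -/
lemma IsSolution.mul_last_le (hγ : IsSolution d γ) {t : ℝ} (ht : t ∈ Set.Ico (0 : ℝ) (d / 2)) :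
    d * γ t (Fin.last d) ≤ 2 * t := by
  rw [← hγ.sum_val_mul ht]
  refine le_trans (le_of_eq ?_) (Finset.single_le_sum
    (f := fun k : Fin (d + 1) => (k : ℝ) * γ t k)
    (fun k _ => mul_nonneg (Nat.cast_nonneg _) (hγ.nonneg ht k)) (Finset.mem_univ (Fin.last d)))
  simp

/-- Mean deficit: `d - 2t = ∑ (d - k) γ_k ≥ ∑_{k < d} γ_k = 1 - γ_d`. Thus `γ_d` tends to `1` at
`d/2`, which keeps `m_δ / n` away from `d/2`. -/
lemma IsSolution.le_last (hγ : IsSolution d γ) {t : ℝ} (ht : t ∈ Set.Ico (0 : ℝ) (d / 2)) :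
    1 - (d - 2 * t) ≤ γ t (Fin.last d) := by
  have h1 := hγ.sum_eq_one ht
  have h2 := hγ.sum_val_mul ht
  rw [Fin.sum_univ_castSucc] at h1 h2
  have h3 : ∑ j : Fin d, ((j.castSucc : Fin (d + 1)) : ℝ) * γ t j.castSucc
      ≤ ∑ j : Fin d, ((d : ℝ) - 1) * γ t j.castSucc := by
    refine Finset.sum_le_sum fun j _ => mul_le_mul_of_nonneg_right ?_ (hγ.nonneg ht _)
    have : ((j : ℕ) : ℝ) + 1 ≤ d := by exact_mod_cast j.2
    simp only [Fin.val_castSucc]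
    linarith
  rw [← Finset.mul_sum] at h3
  simp only [Fin.val_last] at h2
  nlinarith

end Solution

/-! ### Test vectors transported along the solution -/

section Transport

variable {d : ℕ} {γ : ℝ → EuclideanSpace ℝ (Fin (d + 1))} {T : ℝ} {s : ℝ → ℝ}

lemma norm_image_sub_sub_le {E : Type*} [NormedAddCommGroup E] [NormedSpace ℝ E] {f f' : ℝ → E}
    {T K : ℝ} (hK : 0 ≤ K) (hf : ∀ t ∈ Set.Icc 0 T, HasDerivWithinAt f (f' t) (Set.Icc 0 T) t)
    (hf' : ∀ x ∈ Set.Icc 0 T, ∀ y ∈ Set.Icc 0 T, ‖f' y - f' x‖ ≤ K * |y - x|)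
    {x y : ℝ} (hx : 0 ≤ x) (hxy : x ≤ y) (hy : y ≤ T) :
    ‖f y - f x - (y - x) • f' x‖ ≤ K * (y - x) ^ 2 := by
  have hsub : Set.Icc x y ⊆ Set.Icc 0 T := Set.Icc_subset_Icc hx hy
  have h := Convex.norm_image_sub_le_of_norm_hasDerivWithin_le
    (f := fun t => f t - (t - x) • f' x) (f' := fun t => f' t - f' x) (s := Set.Icc x y)
    (C := K * (y - x))
    (fun t ht => by
      simpa using ((hf t (hsub ht)).mono hsub).fun_sub
        (((hasDerivWithinAt_id t (Set.Icc x y)).sub_const x).smul_const (f' x)))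
    (fun t ht => (hf' x (hsub ⟨le_rfl, hxy⟩) t (hsub ht)).trans (by
      rw [abs_of_nonneg (by linarith [ht.1])]
      exact mul_le_mul_of_nonneg_left (by linarith [ht.2]) hK))
    (convex_Icc x y) (Set.left_mem_Icc.2 hxy) (Set.right_mem_Icc.2 hxy)
  simp only [sub_self, zero_smul, sub_zero] at h
  rw [Real.norm_of_nonneg (by linarith : 0 ≤ y - x)] at h
  calc _ = ‖f y - (y - x) • f' x - f x‖ := by congr 1; abel
    _ ≤ _ := h.trans (by rw [mul_assoc, sq])

/-- `s` is the time change with `s' = 2 / (1 - γ_d)`. -/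
structure IsClock (γ : ℝ → EuclideanSpace ℝ (Fin (d + 1))) (T : ℝ) (s : ℝ → ℝ) : Prop where
  zero : s 0 = 0
  deriv : ∀ t ∈ Set.Icc 0 T,
    HasDerivWithinAt s (2 / (1 - γ t (Fin.last d))) (Set.Icc 0 T) t

lemma exists_hasDerivWithinAt {f : ℝ → ℝ} (hT : 0 ≤ T) (hf : ContinuousOn f (Set.Icc 0 T)) :
    ∃ s : ℝ → ℝ, s 0 = 0 ∧ ∀ t ∈ Set.Icc 0 T, HasDerivWithinAt s (f t) (Set.Icc 0 T) t := by
  -- The constant extension beyond `[0, T]` is continuous on the line, so the fundamental theorem of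
  -- calculus also covers the endpoints.
  have hg : Continuous (Set.IccExtend hT ((Set.Icc 0 T).domRestrict f)) :=
    (continuousOn_iff_continuous_domRestrict.1 hf).Icc_extend'
  refine ⟨fun t => ∫ r in (0 : ℝ)..t, Set.IccExtend hT ((Set.Icc 0 T).domRestrict f) r,
    intervalIntegral.integral_same, fun t ht => ?_⟩
  have := (hg.integral_hasStrictDerivAt 0 t).hasDerivAt.hasDerivWithinAt (s := Set.Icc 0 T)
  rwa [Set.IccExtend_of_mem hT _ ht] at this

lemma IsSolution.mem_Ico (hT : T < d / 2) {t : ℝ} (ht : t ∈ Set.Icc 0 T) :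
    t ∈ Set.Ico (0 : ℝ) (d / 2) := ⟨ht.1, ht.2.trans_lt hT⟩

lemma IsSolution.exists_isClock (hγ : IsSolution d γ) (hT0 : 0 ≤ T) (hT : T < d / 2) :
    ∃ s, IsClock γ T s := by
  have hsub : Set.Icc 0 T ⊆ Set.Ico (0 : ℝ) (d / 2) := fun t ht => IsSolution.mem_Ico hT ht
  have hc : ContinuousOn (fun t => 2 / (1 - γ t (Fin.last d))) (Set.Icc 0 T) := by
    refine continuousOn_const.div (continuousOn_const.sub fun t ht => ?_) fun t ht => ?_
    · exact ((hγ.deriv t (hsub ht) _).mono hsub).continuousWithinAt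
    · linarith [hγ.lt_one t (hsub ht)]
  obtain ⟨s, h0, h⟩ := exists_hasDerivWithinAt hT0 hc
  exact ⟨s, h0, h⟩

/-- The test vector which has the value `η` at time `0`, transported to time `t`. -/
def transport (s : ℝ → ℝ) (η : Fin (d + 1) → ℝ) (t : ℝ) : Fin (d + 1) → ℝ := flow d (-s t) η

lemma IsClock.transport_zero (hs : IsClock γ T s) (η : Fin (d + 1) → ℝ) :
    transport s η 0 = η := by
  simp [transport, hs.zero]

lemma shiftDiff_transport (η : Fin (d + 1) → ℝ) (t : ℝ) :
    transport s (shiftDiff d η) t = shiftDiff d (transport s η t) := flow_shiftDiff _ _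

lemma transport_flow (η : Fin (d + 1) → ℝ) (t : ℝ) : transport s (flow d (s t) η) t = η := by
  simp [transport, flow_flow]

lemma IsClock.hasDerivWithinAt_transport (hs : IsClock γ T s) (η : Fin (d + 1) → ℝ) {t : ℝ}
    (ht : t ∈ Set.Icc 0 T) :
    HasDerivWithinAt (transport s η)
      (-(2 / (1 - γ t (Fin.last d))) • shiftDiff d (transport s η t)) (Set.Icc 0 T) t := by
  have h1 := (hasDerivAt_flow d (-s t)).scomp_hasDerivWithinAt t (hs.deriv t ht).fun_neg
  exact ((ContinuousLinearMap.apply ℝ _ η).hasFDerivAt.comp_hasDerivWithinAt t h1)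

lemma IsSolution.hasDerivWithinAt_dotProduct' (hγ : IsSolution d γ) (hT : T < d / 2)
    {a : ℝ → Fin (d + 1) → ℝ} {a' : Fin (d + 1) → ℝ} {t : ℝ} (ht : t ∈ Set.Icc 0 T)
    (ha : HasDerivWithinAt a a' (Set.Icc 0 T) t) :
    HasDerivWithinAt (fun t => a t ⬝ᵥ (γ t).ofLp)
      (a' ⬝ᵥ (γ t).ofLp + 2 / (1 - γ t (Fin.last d)) * (shiftDiff d (a t) ⬝ᵥ (γ t).ofLp))
      (Set.Icc 0 T) t := by
  have hsub : Set.Icc 0 T ⊆ Set.Ico (0 : ℝ) (d / 2) := fun t ht => IsSolution.mem_Ico hT ht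
  rw [← sum_mul_drift, dotProduct, ← Finset.sum_add_distrib]
  exact HasDerivWithinAt.fun_sum fun k _ =>
    ((hasDerivWithinAt_pi.1 ha) k).fun_mul ((hγ.deriv t (hsub ht) k).mono hsub)

lemma eq_of_hasDerivWithinAt_zero {f : ℝ → ℝ} (hf : ∀ t ∈ Set.Icc 0 T, HasDerivWithinAt f 0 (Set.Icc 0 T) t)
    {t : ℝ} (ht : t ∈ Set.Icc 0 T) : f t = f 0 := by
  have := Convex.norm_image_sub_le_of_norm_hasDerivWithin_le (f := f)
    (f' := fun _ => 0) (s := Set.Icc 0 T) (C := 0) hf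
    (by simp) (convex_Icc 0 T) (Set.left_mem_Icc.2 (ht.1.trans ht.2)) ht
  simp only [zero_mul, norm_le_zero_iff] at this
  linarith

lemma IsSolution.transport_dotProduct (hγ : IsSolution d γ) (hT : T < d / 2) (hs : IsClock γ T s)
    (η : Fin (d + 1) → ℝ) {t : ℝ} (ht : t ∈ Set.Icc 0 T) :
    transport s η t ⬝ᵥ (γ t).ofLp = η 0 := by
  rw [eq_of_hasDerivWithinAt_zero (f := fun t => transport s η t ⬝ᵥ (γ t).ofLp) (fun t ht => ?_) ht]
  · simp [hs.transport_zero, hγ.dotProduct_zero]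
  · convert hγ.hasDerivWithinAt_dotProduct' hT ht (hs.hasDerivWithinAt_transport η ht) using 1
    rw [smul_dotProduct, smul_eq_mul]
    ring

/-- The variance of the transported test vector under `γ t`; its mean is constantly `η 0`. -/
def quadVar (γ : ℝ → EuclideanSpace ℝ (Fin (d + 1))) (s : ℝ → ℝ) (η : Fin (d + 1) → ℝ) (t : ℝ) : ℝ :=
  (fun k => transport s η t k ^ 2) ⬝ᵥ (γ t).ofLp - η 0 ^ 2

/-- The derivative of `quadVar`. -/
def quadRate (γ : ℝ → EuclideanSpace ℝ (Fin (d + 1))) (s : ℝ → ℝ) (η : Fin (d + 1) → ℝ) (t : ℝ) : ℝ :=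
  2 / (1 - γ t (Fin.last d)) *
    ((fun k => shiftDiff d (transport s η t) k ^ 2) ⬝ᵥ (γ t).ofLp)

lemma IsSolution.quadVar_zero (hγ : IsSolution d γ) (hs : IsClock γ T s) (η : Fin (d + 1) → ℝ) :
    quadVar γ s η 0 = 0 := by
  simp [quadVar, hγ.dotProduct_zero, hs.transport_zero]

/-- With `g = 2 / (1 - γ_d)` the derivative is `g (D(a²) - 2 a D a) · γ`, and `D(a²) - 2 a D a = (D
a)²` in each coordinate. -/
lemma IsSolution.hasDerivWithinAt_quadVar (hγ : IsSolution d γ) (hT : T < d / 2)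
    (hs : IsClock γ T s) (η : Fin (d + 1) → ℝ) {t : ℝ} (ht : t ∈ Set.Icc 0 T) :
    HasDerivWithinAt (quadVar γ s η) (quadRate γ s η t) (Set.Icc 0 T) t := by
  have h1 : HasDerivWithinAt (fun t => (fun k => transport s η t k ^ 2))
      (fun k => 2 * transport s η t k *
        (-(2 / (1 - γ t (Fin.last d))) * shiftDiff d (transport s η t) k)) (Set.Icc 0 T) t :=
    hasDerivWithinAt_pi.2 fun k => by
      simpa using ((hasDerivWithinAt_pi.1 (hs.hasDerivWithinAt_transport η ht)) k).fun_pow 2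
  refine ((hγ.hasDerivWithinAt_dotProduct' hT ht h1).sub_const (η 0 ^ 2)).congr_deriv ?_
  rw [quadRate, dotProduct, dotProduct, dotProduct, Finset.mul_sum, Finset.mul_sum,
    ← Finset.sum_add_distrib]
  simp only [shiftDiff_apply]
  exact Finset.sum_congr rfl fun k _ => by ring

lemma IsSolution.one_sub_last_ge (hγ : IsSolution d γ) (hd : 0 < d) (hT : T < d / 2) {t : ℝ}
    (ht : t ∈ Set.Icc 0 T) : 1 - 2 * T / d ≤ 1 - γ t (Fin.last d) := by
  have h := hγ.mul_last_le (IsSolution.mem_Ico hT ht)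
  have hd' : (0 : ℝ) < d := by exact_mod_cast hd
  have : γ t (Fin.last d) ≤ 2 * T / d := by
    rw [le_div_iff₀ hd']
    linarith [ht.2]
  linarith

lemma IsSolution.le_one (hγ : IsSolution d γ) {t : ℝ} (ht : t ∈ Set.Ico (0 : ℝ) (d / 2))
    (k : Fin (d + 1)) : γ t k ≤ 1 := by
  rw [← hγ.sum_eq_one ht]
  exact Finset.single_le_sum (f := fun k => γ t k) (fun k _ => hγ.nonneg ht k) (Finset.mem_univ k)

lemma IsSolution.abs_drift_le (hγ : IsSolution d γ) (hd : 0 < d) (hT : T < d / 2) {t : ℝ}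
    (ht : t ∈ Set.Icc 0 T) (k : Fin (d + 1)) : |drift d (γ t) k| ≤ 2 / (1 - 2 * T / d) := by
  have hd' : (0 : ℝ) < d := by exact_mod_cast hd
  have hc : 0 < 1 - 2 * T / d := by
    rw [sub_pos, div_lt_one hd']
    linarith
  have ht' := IsSolution.mem_Ico hT ht
  have h1 := hγ.one_sub_last_ge hd hT ht
  rw [drift, abs_div, abs_of_pos (hc.trans_le h1)]
  refine div_le_div₀ (by norm_num) ?_ hc h1
  have := hγ.le_one ht' k
  have := hγ.le_one ht' (k - 1)
  have := hγ.nonneg ht' k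
  have := hγ.nonneg ht' (k - 1)
  rw [abs_le]
  constructor <;> split_ifs <;> linarith

lemma IsSolution.abs_sub_le (hγ : IsSolution d γ) (hd : 0 < d) (hT : T < d / 2) {x y : ℝ}
    (hx : x ∈ Set.Icc 0 T) (hy : y ∈ Set.Icc 0 T) (k : Fin (d + 1)) :
    |γ y k - γ x k| ≤ 2 / (1 - 2 * T / d) * |y - x| := by
  have hsub : Set.Icc 0 T ⊆ Set.Ico (0 : ℝ) (d / 2) := fun t ht => IsSolution.mem_Ico hT ht
  exact Convex.norm_image_sub_le_of_norm_hasDerivWithin_le (f := fun t => γ t k)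
    (f' := fun t => drift d (γ t) k) (fun t ht => (hγ.deriv t (hsub ht) k).mono hsub)
    (fun t ht => hγ.abs_drift_le hd hT ht k) (convex_Icc 0 T) hx hy

lemma IsSolution.abs_two_div_sub_le (hγ : IsSolution d γ) (hd : 0 < d) (hT : T < d / 2) {x y : ℝ}
    (hx : x ∈ Set.Icc 0 T) (hy : y ∈ Set.Icc 0 T) :
    |2 / (1 - γ y (Fin.last d)) - 2 / (1 - γ x (Fin.last d))|
      ≤ 4 / (1 - 2 * T / d) ^ 3 * |y - x| := by
  have hd' : (0 : ℝ) < d := by exact_mod_cast hd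
  have hc : 0 < 1 - 2 * T / d := by
    rw [sub_pos, div_lt_one hd']
    linarith
  have h1 := hγ.one_sub_last_ge hd hT hx
  have h2 := hγ.one_sub_last_ge hd hT hy
  have h3 := hγ.abs_sub_le hd hT hx hy (Fin.last d)
  set c := 1 - 2 * T / d
  set u := γ x (Fin.last d)
  set v := γ y (Fin.last d)
  have hu : 0 < 1 - u := hc.trans_le h1
  have hv : 0 < 1 - v := hc.trans_le h2
  rw [show 2 / (1 - v) - 2 / (1 - u) = 2 * (v - u) / ((1 - v) * (1 - u)) by field_simp; ring,
    abs_div, abs_mul, abs_of_pos (mul_pos hv hu), abs_two]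
  calc 2 * |v - u| / ((1 - v) * (1 - u)) ≤ 2 * (2 / c * |y - x|) / (c * c) := by gcongr
    _ = _ := by field_simp; ring

/-- Bounds, uniform over `η` in a ball and over `[0, T]`, on the transported test vectors. -/
structure TransportBounds (γ : ℝ → EuclideanSpace ℝ (Fin (d + 1))) (T : ℝ) (s : ℝ → ℝ) (R K : ℝ) :
    Prop where
  norm_le : ∀ η : Fin (d + 1) → ℝ, ‖η‖ ≤ R → ∀ t ∈ Set.Icc 0 T, ‖transport s η t‖ ≤ K
  norm_sub_le : ∀ η : Fin (d + 1) → ℝ, ‖η‖ ≤ R → ∀ x y, 0 ≤ x → x ≤ y → y ≤ T →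
    ‖transport s η y - transport s η x‖ ≤ K * (y - x)
  taylor : ∀ η : Fin (d + 1) → ℝ, ‖η‖ ≤ R → ∀ x y, 0 ≤ x → x ≤ y → y ≤ T →
    ‖transport s η y - transport s η x
      + ((y - x) * (2 / (1 - γ x (Fin.last d)))) • shiftDiff d (transport s η x)‖ ≤ K * (y - x) ^ 2
  quad_taylor : ∀ η : Fin (d + 1) → ℝ, ‖η‖ ≤ R → ∀ x y, 0 ≤ x → x ≤ y → y ≤ T →
    |quadVar γ s η y - quadVar γ s η x - (y - x) * quadRate γ s η x| ≤ K * (y - x) ^ 2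
  rate_le : ∀ η : Fin (d + 1) → ℝ, ‖η‖ ≤ R → ∀ t ∈ Set.Icc 0 T, |quadRate γ s η t| ≤ K
  var_le : ∀ η : Fin (d + 1) → ℝ, ‖η‖ ≤ R → ∀ t ∈ Set.Icc 0 T, |quadVar γ s η t| ≤ K

lemma IsClock.exists_norm_flow_le (hs : IsClock γ T s) :
    ∃ K, 0 ≤ K ∧ ∀ t ∈ Set.Icc 0 T, ‖flow d (s t)‖ ≤ K ∧ ‖flow d (-s t)‖ ≤ K := by
  have hc : ContinuousOn s (Set.Icc 0 T) := fun t ht => (hs.deriv t ht).continuousWithinAt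
  obtain ⟨K₁, h₁⟩ := isCompact_Icc.exists_bound_of_continuousOn
    ((continuous_flow d).comp_continuousOn hc)
  obtain ⟨K₂, h₂⟩ := isCompact_Icc.exists_bound_of_continuousOn
    ((continuous_flow d).comp_continuousOn hc.fun_neg)
  exact ⟨max 0 (max K₁ K₂), le_max_left _ _, fun t ht =>
    ⟨(h₁ t ht).trans (by simp), (h₂ t ht).trans (by simp)⟩⟩

lemma IsSolution.abs_dotProduct_le (hγ : IsSolution d γ) (hT : T < d / 2) {t : ℝ}
    (ht : t ∈ Set.Icc 0 T) (a : Fin (d + 1) → ℝ) {C : ℝ} (ha : ∀ k, |a k| ≤ C) :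
    |a ⬝ᵥ (γ t).ofLp| ≤ C := by
  have ht' := IsSolution.mem_Ico hT ht
  calc |a ⬝ᵥ (γ t).ofLp| ≤ ∑ k, |a k * γ t k| := Finset.abs_sum_le_sum_abs _ _
    _ ≤ ∑ k, C * γ t k := Finset.sum_le_sum fun k _ => by
      rw [abs_mul, abs_of_nonneg (hγ.nonneg ht' k)]
      exact mul_le_mul_of_nonneg_right (ha k) (hγ.nonneg ht' k)
    _ = C := by rw [← Finset.mul_sum, hγ.sum_eq_one ht', mul_one]

lemma abs_sq_sub_sq_le {x y a b : ℝ} (h : |x - y| ≤ a) (hx : |x| ≤ b) (hy : |y| ≤ b) :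
    |x ^ 2 - y ^ 2| ≤ a * (2 * b) := by
  rw [show x ^ 2 - y ^ 2 = (x - y) * (x + y) by ring, abs_mul]
  exact mul_le_mul h ((abs_add_le x y).trans (by linarith)) (abs_nonneg _)
    ((abs_nonneg _).trans h)

lemma sq_le_of_abs_le {x b : ℝ} (hx : |x| ≤ b) : |x ^ 2| ≤ b ^ 2 := by
  rw [abs_pow]
  exact pow_le_pow_left₀ (abs_nonneg x) hx 2

/-- On `[0, T]` the flow is bounded and `1 - γ_d` is bounded below, so the derivatives of the
transported vectors and of `quadVar` are bounded and Lipschitz; this gives the quadratic Taylor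
remainders. Uniformity in `η` is needed because the `η` chosen later depends on the time. -/
lemma IsSolution.exists_transportBounds (hγ : IsSolution d γ) (hd : 0 < d) (hT : T < d / 2)
    (hs : IsClock γ T s) {R : ℝ} (hR : 0 ≤ R) : ∃ K, 1 ≤ K ∧ TransportBounds γ T s R K := by
  have hd' : (0 : ℝ) < d := by exact_mod_cast hd
  have hc : 0 < 1 - 2 * T / d := by
    rw [sub_pos, div_lt_one hd']
    linarith
  obtain ⟨P, hP, hflow⟩ := hs.exists_norm_flow_le
  set G : ℝ := 2 / (1 - 2 * T / d)
  set G' : ℝ := 4 / (1 - 2 * T / d) ^ 3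
  have hG : 0 ≤ G := by positivity
  have hG' : 0 ≤ G' := by positivity
  set g : ℝ → ℝ := fun t => 2 / (1 - γ t (Fin.last d)) with hg
  have hgb : ∀ t ∈ Set.Icc 0 T, |g t| ≤ G := fun t ht => by
    have h1 := hγ.one_sub_last_ge hd hT ht
    rw [hg, abs_div, abs_two, abs_of_pos (hc.trans_le h1)]
    exact div_le_div_of_nonneg_left (by norm_num) hc h1
  set M := P * R
  have hM : 0 ≤ M := by positivity
  have ha : ∀ η : Fin (d + 1) → ℝ, ‖η‖ ≤ R → ∀ t ∈ Set.Icc 0 T, ‖transport s η t‖ ≤ M :=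
    fun η hη t ht => ((flow d (-s t)).le_opNorm η).trans
      (mul_le_mul (hflow t ht).2 hη (norm_nonneg _) hP)
  have hDa : ∀ η : Fin (d + 1) → ℝ, ‖η‖ ≤ R → ∀ t ∈ Set.Icc 0 T,
      ‖shiftDiff d (transport s η t)‖ ≤ 2 * M :=
    fun η hη t ht => (norm_shiftDiff_le _).trans (by linarith [ha η hη t ht])
  set A := G * (2 * M)
  have hA : 0 ≤ A := by positivity
  have hal : ∀ η : Fin (d + 1) → ℝ, ‖η‖ ≤ R → ∀ x ∈ Set.Icc 0 T, ∀ y ∈ Set.Icc 0 T,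
      ‖transport s η y - transport s η x‖ ≤ A * |y - x| := fun η hη x hx y hy =>
    Convex.norm_image_sub_le_of_norm_hasDerivWithin_le (f := transport s η)
      (fun t ht => hs.hasDerivWithinAt_transport η ht)
      (fun t ht => by
        rw [norm_smul, norm_neg]
        exact mul_le_mul (hgb t ht) (hDa η hη t ht) (norm_nonneg _) hG) (convex_Icc 0 T) hx hy
  have hDal : ∀ η : Fin (d + 1) → ℝ, ‖η‖ ≤ R → ∀ x ∈ Set.Icc 0 T, ∀ y ∈ Set.Icc 0 T,
      ‖shiftDiff d (transport s η y) - shiftDiff d (transport s η x)‖ ≤ 2 * A * |y - x| :=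
    fun η hη x hx y hy => by
      rw [← map_sub]
      exact (norm_shiftDiff_le _).trans (by linarith [hal η hη x hx y hy])
  set B := G' * (2 * M) + G * (2 * A)
  have hB : 0 ≤ B := by positivity
  have hderiv : ∀ η : Fin (d + 1) → ℝ, ‖η‖ ≤ R → ∀ x ∈ Set.Icc 0 T, ∀ y ∈ Set.Icc 0 T,
      ‖-g y • shiftDiff d (transport s η y) - -g x • shiftDiff d (transport s η x)‖
        ≤ B * |y - x| := fun η hη x hx y hy => by
    rw [show -g y • shiftDiff d (transport s η y) - -g x • shiftDiff d (transport s η x)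
      = -((g y - g x) • shiftDiff d (transport s η y))
        - g x • (shiftDiff d (transport s η y) - shiftDiff d (transport s η x)) by module]
    refine (norm_sub_le _ _).trans ?_
    rw [norm_neg, norm_smul, norm_smul, add_mul, mul_assoc G]
    refine add_le_add ?_ (mul_le_mul (hgb x hx) (hDal η hη x hx y hy) (norm_nonneg _) hG)
    calc _ ≤ G' * |y - x| * (2 * M) := mul_le_mul (hγ.abs_two_div_sub_le hd hT hx hy)
          (hDa η hη y hy) (norm_nonneg _) (by positivity)
      _ = _ := by ring
  set p : (Fin (d + 1) → ℝ) → ℝ → ℝ := fun η t =>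
    (fun k => shiftDiff d (transport s η t) k ^ 2) ⬝ᵥ (γ t).ofLp
  have hk : ∀ η : Fin (d + 1) → ℝ, ‖η‖ ≤ R → ∀ t ∈ Set.Icc 0 T, ∀ k,
      |shiftDiff d (transport s η t) k| ≤ 2 * M := fun η hη t ht k =>
    (norm_le_pi_norm (shiftDiff d (transport s η t)) k).trans (hDa η hη t ht)
  have hpb : ∀ η : Fin (d + 1) → ℝ, ‖η‖ ≤ R → ∀ t ∈ Set.Icc 0 T, |p η t| ≤ (2 * M) ^ 2 :=
    fun η hη t ht => hγ.abs_dotProduct_le hT ht _ fun k => sq_le_of_abs_le (hk η hη t ht k)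
  set C := 2 * A * (2 * (2 * M)) + (d + 1) * ((2 * M) ^ 2 * G)
  have hC : 0 ≤ C := by positivity
  have hpl : ∀ η : Fin (d + 1) → ℝ, ‖η‖ ≤ R → ∀ x ∈ Set.Icc 0 T, ∀ y ∈ Set.Icc 0 T,
      |p η y - p η x| ≤ C * |y - x| := fun η hη x hx y hy => by
    rw [show p η y - p η x = (fun k => shiftDiff d (transport s η y) k ^ 2
          - shiftDiff d (transport s η x) k ^ 2) ⬝ᵥ (γ y).ofLp
        + ∑ k, shiftDiff d (transport s η x) k ^ 2 * (γ y k - γ x k) by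
      simp only [p, dotProduct, ← Finset.sum_add_distrib, ← Finset.sum_sub_distrib]
      exact Finset.sum_congr rfl fun k _ => by ring]
    refine (abs_add_le _ _).trans ?_
    rw [add_mul]
    refine add_le_add ?_ ?_
    · refine hγ.abs_dotProduct_le hT hy _ fun k => ?_
      refine (abs_sq_sub_sq_le ?_ (hk η hη y hy k) (hk η hη x hx k)).trans
        (le_of_eq (by ring : 2 * A * |y - x| * (2 * (2 * M)) = _))
      exact (norm_le_pi_norm (shiftDiff d (transport s η y) - shiftDiff d (transport s η x)) k).trans
        (hDal η hη x hx y hy)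
    · refine (Finset.abs_sum_le_sum_abs _ _).trans ?_
      refine (Finset.sum_le_card_nsmul _ _ ((2 * M) ^ 2 * (G * |y - x|)) fun k _ => ?_).trans ?_
      · rw [abs_mul]
        exact mul_le_mul (sq_le_of_abs_le (hk η hη x hx k)) (hγ.abs_sub_le hd hT hx hy k)
          (abs_nonneg _) (by positivity)
      · simp only [Finset.card_univ, Fintype.card_fin, nsmul_eq_mul]
        push_cast
        exact le_of_eq (by ring)
  set E := G' * (2 * M) ^ 2 + G * C
  have hE : 0 ≤ E := by positivity
  have hql : ∀ η : Fin (d + 1) → ℝ, ‖η‖ ≤ R → ∀ x ∈ Set.Icc 0 T, ∀ y ∈ Set.Icc 0 T,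
      ‖quadRate γ s η y - quadRate γ s η x‖ ≤ E * |y - x| := fun η hη x hx y hy => by
    rw [show quadRate γ s η y - quadRate γ s η x
      = (g y - g x) * p η y + g x * (p η y - p η x) by simp only [quadRate, g, p]; ring]
    refine (norm_add_le _ _).trans ?_
    rw [norm_mul, norm_mul, add_mul, mul_assoc G]
    refine add_le_add ?_ (mul_le_mul (hgb x hx) (hpl η hη x hx y hy) (norm_nonneg _) hG)
    calc _ ≤ G' * |y - x| * (2 * M) ^ 2 := mul_le_mul (hγ.abs_two_div_sub_le hd hT hx hy)
          (hpb η hη y hy) (abs_nonneg _) (by positivity)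
      _ = _ := by ring
  set F := G * (2 * M) ^ 2
  set H := M ^ 2 + R ^ 2
  have hF : 0 ≤ F := by positivity
  have hH : 0 ≤ H := by positivity
  refine ⟨1 + M + A + B + E + F + H, by linarith, ⟨fun η hη t ht => ?_, fun η hη x y hx hxy hy => ?_,
    fun η hη x y hx hxy hy => ?_, fun η hη x y hx hxy hy => ?_, fun η hη t ht => ?_,
    fun η hη t ht => ?_⟩⟩
  · linarith [ha η hη t ht]
  · have := hal η hη x ⟨hx, hxy.trans hy⟩ y ⟨hx.trans hxy, hy⟩
    rw [abs_of_nonneg (by linarith)] at this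
    exact this.trans (mul_le_mul_of_nonneg_right (by linarith) (by linarith))
  · have := norm_image_sub_sub_le hB (fun t ht => hs.hasDerivWithinAt_transport η ht) (hderiv η hη)
      hx hxy hy
    rw [neg_smul, smul_neg, sub_neg_eq_add, smul_smul] at this
    exact this.trans (mul_le_mul_of_nonneg_right (by linarith) (by positivity))
  · have := norm_image_sub_sub_le hE (fun t ht => hγ.hasDerivWithinAt_quadVar hT hs η ht) (hql η hη)
      hx hxy hy
    exact this.trans (mul_le_mul_of_nonneg_right (by linarith) (by positivity))
  · have : |quadRate γ s η t| ≤ F := by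
      rw [quadRate, abs_mul]
      exact mul_le_mul (hgb t ht) (hpb η hη t ht) (abs_nonneg _) hG
    linarith
  · have h1 : |(fun k => transport s η t k ^ 2) ⬝ᵥ (γ t).ofLp| ≤ M ^ 2 :=
      hγ.abs_dotProduct_le hT ht _ fun k =>
        sq_le_of_abs_le ((norm_le_pi_norm (transport s η t) k).trans (ha η hη t ht))
    have h2 : |η 0 ^ 2| ≤ R ^ 2 := sq_le_of_abs_le ((norm_le_pi_norm η 0).trans hη)
    rw [quadVar]
    linarith [abs_sub ((fun k => transport s η t k ^ 2) ⬝ᵥ (γ t).ofLp) (η 0 ^ 2)]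

end Transport

/-! ### Expectations over finite probability mass functions -/

section Expectation

variable {α β : Type*} [Fintype α] [Fintype β] {E : Type*} [NormedAddCommGroup E] [NormedSpace ℝ E]

/-- The expectation of `f` under `p`. -/
def expect (p : PMF α) (f : α → E) : E := ∑ a, (p a).toReal • f a

lemma expect_pure (a : α) (f : α → E) : expect (PMF.pure a) f = f a := by
  classical
  rw [expect, Finset.sum_eq_single a]
  · simp
  · intro b _ hb
    simp [PMF.pure_apply, hb]
  · simp

lemma expect_bind (p : PMF α) (q : α → PMF β) (f : β → E) :
    expect (p.bind q) f = expect p fun a => expect (q a) f := by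
  simp only [expect, PMF.bind_apply, tsum_fintype, Finset.smul_sum]
  rw [Finset.sum_comm]
  refine Finset.sum_congr rfl fun b _ => ?_
  rw [ENNReal.toReal_sum fun a _ => ENNReal.mul_ne_top (p.apply_ne_top a) ((q a).apply_ne_top b),
    Finset.sum_smul]
  exact Finset.sum_congr rfl fun a _ => by rw [ENNReal.toReal_mul, mul_smul]

lemma expect_map_uniformOfFinset (t : Finset α) (ht : t.Nonempty) (g : α → β) (f : β → E) :
    expect ((PMF.uniformOfFinset t ht).map g) f = ((t.card : ℝ)⁻¹) • ∑ a ∈ t, f (g a) := by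
  classical
  rw [← PMF.bind_pure_comp, expect_bind]
  simp only [Function.comp_apply, expect_pure]
  rw [expect, Finset.smul_sum, ← Finset.sum_subset (Finset.subset_univ t)]
  · refine Finset.sum_congr rfl fun a ha => ?_
    rw [PMF.uniformOfFinset_apply_of_mem _ ha]
    simp
  · intro a _ ha
    rw [PMF.uniformOfFinset_apply_of_notMem _ ha]
    simp

lemma expect_congr {p : PMF α} {f g : α → E} (h : ∀ a ∈ p.support, f a = g a) :
    expect p f = expect p g := by
  refine Finset.sum_congr rfl fun a _ => ?_
  by_cases ha : a ∈ p.support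
  · rw [h a ha]
  · rw [(PMF.apply_eq_zero_iff p a).2 ha]
    simp

lemma sum_toReal_eq_one (p : PMF α) : ∑ a, (p a).toReal = 1 := by
  rw [← ENNReal.toReal_sum fun a _ => p.apply_ne_top a, ← tsum_fintype (L := .unconditional _),
    p.tsum_coe, ENNReal.toReal_one]

lemma expect_const (p : PMF α) (c : E) : expect p (fun _ => c) = c := by
  rw [expect, ← Finset.sum_smul, sum_toReal_eq_one, one_smul]

lemma expect_add (p : PMF α) (f g : α → E) :
    expect p (fun a => f a + g a) = expect p f + expect p g := by
  simp [expect, Finset.sum_add_distrib]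

lemma expect_sub (p : PMF α) (f g : α → E) :
    expect p (fun a => f a - g a) = expect p f - expect p g := by
  simp [expect, smul_sub, Finset.sum_sub_distrib]

lemma expect_const_mul (p : PMF α) (c : ℝ) (f : α → ℝ) :
    expect p (fun a => c * f a) = c * expect p f := by
  simp only [expect, Finset.mul_sum, smul_eq_mul]
  exact Finset.sum_congr rfl fun a _ => by ring

lemma expect_mul_const_complex (p : PMF α) (f : α → ℂ) (c : ℂ) :
    expect p (fun a => f a * c) = expect p f * c := by
  simp only [expect, Finset.sum_mul, smul_mul_assoc]

lemma expect_const_mul_complex (p : PMF α) (f : α → ℂ) (c : ℂ) :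
    expect p (fun a => c * f a) = c * expect p f := by
  simp only [expect, Finset.mul_sum, mul_smul_comm]

lemma expect_ofReal (p : PMF α) (f : α → ℝ) :
    expect p (fun a => (f a : ℂ)) = (expect p f : ℝ) := by
  simp [expect]

lemma expect_sum {ι : Type*} (t : Finset ι) (p : PMF α) (f : ι → α → E) :
    expect p (fun a => ∑ i ∈ t, f i a) = ∑ i ∈ t, expect p (f i) := by
  simp only [expect, Finset.smul_sum]
  exact Finset.sum_comm

lemma expect_mono {p : PMF α} {f g : α → ℝ} (h : ∀ a ∈ p.support, f a ≤ g a) :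
    expect p f ≤ expect p g := by
  refine Finset.sum_le_sum fun a _ => ?_
  by_cases ha : a ∈ p.support
  · exact mul_le_mul_of_nonneg_left (h a ha) ENNReal.toReal_nonneg
  · rw [(PMF.apply_eq_zero_iff p a).2 ha]
    simp

lemma norm_expect_le (p : PMF α) (f : α → E) : ‖expect p f‖ ≤ expect p fun a => ‖f a‖ := by
  refine (norm_sum_le _ _).trans (le_of_eq (Finset.sum_congr rfl fun a _ => ?_))
  rw [norm_smul, Real.norm_of_nonneg ENNReal.toReal_nonneg, smul_eq_mul]

lemma norm_expect_le_of_le {p : PMF α} {f : α → E} {g : α → ℝ} (h : ∀ a ∈ p.support, ‖f a‖ ≤ g a) :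
    ‖expect p f‖ ≤ expect p g := (norm_expect_le p f).trans (expect_mono h)

/-- Averages over a set and over a large subset are close. -/
lemma abs_mean_sub_mean_le {ι : Type*} [DecidableEq ι] {t u : Finset ι} (htu : t ⊆ u)
    (ht : t.Nonempty)
    {f : ι → ℝ} {B : ℝ} (hf : ∀ i ∈ u, |f i| ≤ B) :
    |(t.card : ℝ)⁻¹ * ∑ i ∈ t, f i - (u.card : ℝ)⁻¹ * ∑ i ∈ u, f i|
      ≤ 2 * B * ((u \ t).card / u.card) := by
  have htc : (0 : ℝ) < t.card := by exact_mod_cast ht.card_pos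
  have huc : (t.card : ℝ) ≤ u.card := by exact_mod_cast Finset.card_le_card htu
  have hu : (0 : ℝ) < u.card := htc.trans_le huc
  have hsd : ((u \ t).card : ℝ) = u.card - t.card := by
    rw [Finset.card_sdiff_of_subset htu, Nat.cast_sub (Finset.card_le_card htu)]
  have h1 : |∑ i ∈ t, f i| ≤ t.card * B := by
    refine (Finset.abs_sum_le_sum_abs _ _).trans ?_
    simpa using Finset.sum_le_card_nsmul t (fun i => |f i|) B fun i hi => hf i (htu hi)
  have h2 : |∑ i ∈ u \ t, f i| ≤ (u \ t).card * B := by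
    refine (Finset.abs_sum_le_sum_abs _ _).trans ?_
    simpa using Finset.sum_le_card_nsmul (u \ t) (fun i => |f i|) B
      fun i hi => hf i (Finset.sdiff_subset hi)
  have hinv : 0 ≤ (t.card : ℝ)⁻¹ - (u.card : ℝ)⁻¹ :=
    sub_nonneg.2 (inv_anti₀ htc huc)
  rw [← Finset.sum_sdiff htu, show (t.card : ℝ)⁻¹ * ∑ i ∈ t, f i - (u.card : ℝ)⁻¹ *
      (∑ i ∈ u \ t, f i + ∑ i ∈ t, f i) = ((t.card : ℝ)⁻¹ - (u.card : ℝ)⁻¹) * ∑ i ∈ t, f i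
      - (u.card : ℝ)⁻¹ * ∑ i ∈ u \ t, f i by ring]
  refine (abs_sub _ _).trans ?_
  rw [abs_mul, abs_mul, abs_of_nonneg hinv, abs_of_pos (inv_pos.2 hu)]
  calc _ ≤ ((t.card : ℝ)⁻¹ - (u.card : ℝ)⁻¹) * (t.card * B)
        + (u.card : ℝ)⁻¹ * ((u \ t).card * B) := by gcongr
    _ = _ := by
      rw [hsd]
      field_simp
      ring

end Expectation

/-! ### One step of the process -/

section Step

open scoped Classical

variable {d n : ℕ}

/-- The degree of `v`, truncated at `d`. -/
def degClass (d : ℕ) (G : SimpleGraph (Fin n)) (v : Fin n) : Fin (d + 1) :=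
  ⟨min (G.degree v) d, by omega⟩

/-- The sum over the vertices of a function of the degree. -/
def total (d : ℕ) (G : SimpleGraph (Fin n)) (a : Fin (d + 1) → ℝ) : ℝ := ∑ v, a (degClass d G v)

/-- The vertices of degree less than `d`. -/
def unsaturated (d : ℕ) (G : SimpleGraph (Fin n)) : Finset (Fin n) :=
  Finset.univ.filter fun v => G.degree v < d

lemma mem_eligible {G : SimpleGraph (Fin n)} {p : Fin n × Fin n} : p ∈ eligible d G ↔
    p.1 ≠ p.2 ∧ ¬ G.Adj p.1 p.2 ∧ G.degree p.1 < d ∧ G.degree p.2 < d := by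
  simp [eligible]

lemma total_eq_sum_degreeCounts {G : SimpleGraph (Fin n)} (hG : ∀ v, G.degree v ≤ d)
    (a : Fin (d + 1) → ℝ) : total d G a = a ⬝ᵥ (degreeCounts d G).ofLp := by
  rw [total, ← Finset.sum_fiberwise (s := Finset.univ) (g := degClass d G)]
  refine Finset.sum_congr rfl fun k _ => ?_
  rw [Finset.sum_congr rfl (g := fun _ => a k) fun v hv => by rw [(Finset.mem_filter.1 hv).2]]
  rw [Finset.sum_const, nsmul_eq_mul, mul_comm]
  simp only [degreeCounts]
  congr 3
  ext v
  have := hG v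
  simp [degClass, Fin.ext_iff, this]

lemma total_add (G : SimpleGraph (Fin n)) (a b : Fin (d + 1) → ℝ) :
    total d G (a + b) = total d G a + total d G b := by
  simp [total, Finset.sum_add_distrib]

lemma total_sub (G : SimpleGraph (Fin n)) (a b : Fin (d + 1) → ℝ) :
    total d G (a - b) = total d G a - total d G b := by
  simp [total, Finset.sum_sub_distrib]

lemma total_smul (G : SimpleGraph (Fin n)) (c : ℝ) (a : Fin (d + 1) → ℝ) :
    total d G (c • a) = c * total d G a := by
  simp [total, Finset.mul_sum]

lemma abs_total_le (G : SimpleGraph (Fin n)) (a : Fin (d + 1) → ℝ) :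
    |total d G a| ≤ n * ‖a‖ := by
  refine (Finset.abs_sum_le_sum_abs _ _).trans ?_
  simpa using Finset.sum_le_card_nsmul Finset.univ (fun v => |a (degClass d G v)|) ‖a‖
    fun v _ => norm_le_pi_norm a _

lemma degree_sup_edge {G : SimpleGraph (Fin n)} {x y : Fin n} (hxy : x ≠ y) (h : ¬ G.Adj x y)
    (v : Fin n) [Fintype ((G ⊔ SimpleGraph.edge x y).neighborSet v)] :
    (G ⊔ SimpleGraph.edge x y).degree v
      = G.degree v + if v = x ∨ v = y then 1 else 0 := by
  have hyx : ¬ G.Adj y x := fun h' => h h'.symm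
  by_cases hv : v = x ∨ v = y
  · rw [if_pos hv]
    rcases hv with rfl | rfl
    · have : (G ⊔ SimpleGraph.edge v y).neighborFinset v = insert y (G.neighborFinset v) := by
        ext w
        simp only [SimpleGraph.mem_neighborFinset, SimpleGraph.sup_adj, SimpleGraph.edge_adj,
          Finset.mem_insert]
        grind
      rw [← SimpleGraph.card_neighborFinset_eq_degree, this, Finset.card_insert_of_notMem (by simpa),
        SimpleGraph.card_neighborFinset_eq_degree]
    · have : (G ⊔ SimpleGraph.edge x v).neighborFinset v = insert x (G.neighborFinset v) := by
        ext w
        simp only [SimpleGraph.mem_neighborFinset, SimpleGraph.sup_adj, SimpleGraph.edge_adj,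
          Finset.mem_insert]
        grind
      rw [← SimpleGraph.card_neighborFinset_eq_degree, this, Finset.card_insert_of_notMem (by simpa),
        SimpleGraph.card_neighborFinset_eq_degree]
  · rw [if_neg hv, add_zero, ← SimpleGraph.card_neighborFinset_eq_degree,
      ← SimpleGraph.card_neighborFinset_eq_degree]
    congr 1
    ext w
    simp only [SimpleGraph.mem_neighborFinset, SimpleGraph.sup_adj, SimpleGraph.edge_adj]
    grind

lemma degClass_sup_edge {G : SimpleGraph (Fin n)} {p : Fin n × Fin n} (hp : p ∈ eligible d G)
    (v : Fin n) : degClass d (G ⊔ SimpleGraph.edge p.1 p.2) v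
      = if v = p.1 ∨ v = p.2 then next (degClass d G v) else degClass d G v := by
  obtain ⟨h1, h2, h3, h4⟩ := mem_eligible.1 hp
  ext
  change min _ d = _
  rw [degree_sup_edge h1 h2]
  split_ifs with h
  · have : G.degree v < d := by rcases h with rfl | rfl <;> assumption
    simp only [degClass, next]
    omega
  · simp [degClass]

lemma total_sup_edge {G : SimpleGraph (Fin n)} {p : Fin n × Fin n} (hp : p ∈ eligible d G)
    (a : Fin (d + 1) → ℝ) : total d (G ⊔ SimpleGraph.edge p.1 p.2) a
      = total d G a + (shiftDiff d a (degClass d G p.1) + shiftDiff d a (degClass d G p.2)) := by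
  have h1 := (mem_eligible.1 hp).1
  rw [total, total, ← sub_eq_iff_eq_add', ← Finset.sum_sub_distrib,
    ← Finset.sum_subset (Finset.subset_univ {p.1, p.2}), Finset.sum_pair h1]
  · simp [degClass_sup_edge hp]
  · intro v _ hv
    rw [degClass_sup_edge hp, if_neg (by simpa using hv), sub_self]

/-- A pair of unsaturated vertices is ineligible only if the second is the first or one of its
neighbours: at most `1 + (d - 1)` choices. -/
lemma card_unsaturated_sq_sdiff_le (G : SimpleGraph (Fin n)) :
    ((unsaturated d G ×ˢ unsaturated d G) \ eligible d G).card ≤ (unsaturated d G).card * d := by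
  have hsub : (unsaturated d G ×ˢ unsaturated d G) \ eligible d G ⊆
      ((unsaturated d G).sigma (fun v => insert v (G.neighborFinset v))).map
        (Equiv.sigmaEquivProd _ _).toEmbedding := by
    rintro ⟨v, w⟩ h
    simp only [Finset.mem_sdiff, Finset.mem_product, mem_eligible, unsaturated,
      Finset.mem_filter, Finset.mem_univ, true_and] at h
    simp only [Finset.mem_map_equiv, Finset.mem_sigma, unsaturated, Finset.mem_filter,
      Finset.mem_univ, true_and, Finset.mem_insert, SimpleGraph.mem_neighborFinset,
      Equiv.sigmaEquivProd_symm_apply]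
    grind
  refine (Finset.card_le_card hsub).trans ?_
  rw [Finset.card_map, Finset.card_sigma]
  refine (Finset.sum_le_card_nsmul _ _ d fun v hv => ?_).trans (by simp)
  rw [Finset.card_insert_of_notMem (by simp), SimpleGraph.card_neighborFinset_eq_degree]
  exact (Finset.mem_filter.1 hv).2

lemma eligible_subset (G : SimpleGraph (Fin n)) :
    eligible d G ⊆ unsaturated d G ×ˢ unsaturated d G := by
  intro p hp
  have := mem_eligible.1 hp
  simp [unsaturated, this]

lemma eligible_nonempty {G : SimpleGraph (Fin n)} (hu : d < (unsaturated d G).card) :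
    (eligible d G).Nonempty := by
  rw [Finset.nonempty_iff_ne_empty]
  intro h
  have := card_unsaturated_sq_sdiff_le (d := d) G
  rw [h, Finset.sdiff_empty, Finset.card_product] at this
  have := Nat.le_of_mul_le_mul_left this (by omega)
  omega

lemma expect_step {E : Type*} [NormedAddCommGroup E] [NormedSpace ℝ E] {G : SimpleGraph (Fin n)}
    (hu : d < (unsaturated d G).card) (f : SimpleGraph (Fin n) → E) :
    expect (step d G) f = ((eligible d G).card : ℝ)⁻¹ •
      ∑ p ∈ eligible d G, f (G ⊔ SimpleGraph.edge p.1 p.2) := by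
  rw [step, dif_pos (eligible_nonempty hu), expect_map_uniformOfFinset]

/-- Ineligible pairs are a fraction at most `d / u` of the square of the unsaturated set, and
averages over the full square factorise. -/
lemma abs_mean_eligible_sub_le {G : SimpleGraph (Fin n)} (hu : d < (unsaturated d G).card)
    {f : Fin n × Fin n → ℝ} {B : ℝ} (hB : 0 ≤ B) (hf : ∀ p, |f p| ≤ B) :
    |((eligible d G).card : ℝ)⁻¹ * ∑ p ∈ eligible d G, f p - (((unsaturated d G).card : ℝ) ^ 2)⁻¹ *
      ∑ v ∈ unsaturated d G, ∑ w ∈ unsaturated d G, f (v, w)|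
      ≤ 2 * B * (d / (unsaturated d G).card) := by
  have h := abs_mean_sub_mean_le (eligible_subset (d := d) G) (eligible_nonempty hu)
    (fun p _ => hf p)
  rw [Finset.card_product, Nat.cast_mul, Finset.sum_product, ← sq] at h
  refine h.trans (mul_le_mul_of_nonneg_left ?_ (by positivity))
  have hpos : (0 : ℝ) < (unsaturated d G).card := by exact_mod_cast (Nat.zero_le d).trans_lt hu
  rw [div_le_div_iff₀ (by positivity) hpos]
  have : ((((unsaturated d G ×ˢ unsaturated d G) \ eligible d G).card : ℕ) : ℝ)
      ≤ (unsaturated d G).card * d := by exact_mod_cast card_unsaturated_sq_sdiff_le (d := d) G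
  calc _ ≤ ((unsaturated d G).card : ℝ) * d * (unsaturated d G).card := by gcongr
    _ = _ := by ring

lemma sum_unsaturated {G : SimpleGraph (Fin n)} {g : Fin (d + 1) → ℝ}
    (hg : g (Fin.last d) = 0) : ∑ v ∈ unsaturated d G, g (degClass d G v) = total d G g := by
  refine Finset.sum_subset (Finset.subset_univ _) fun v _ hv => ?_
  have h : degClass d G v = Fin.last d := by
    ext
    simp only [unsaturated, Finset.mem_filter, Finset.mem_univ, true_and, not_lt] at hv
    simp [degClass, hv]
  rw [h, hg]

/-- The mean over the eligible pairs of the sum of a function of the degrees. -/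
lemma abs_mean_add_sub_le {G : SimpleGraph (Fin n)}
    (hu : d < (unsaturated d G).card) {g : Fin (d + 1) → ℝ} (hg : g (Fin.last d) = 0) :
    |((eligible d G).card : ℝ)⁻¹ * ∑ p ∈ eligible d G, (g (degClass d G p.1) + g (degClass d G p.2))
      - 2 * total d G g / (unsaturated d G).card| ≤ 4 * d * ‖g‖ / (unsaturated d G).card := by
  have h := abs_mean_eligible_sub_le hu
    (f := fun p => g (degClass d G p.1) + g (degClass d G p.2)) (B := 2 * ‖g‖) (by positivity)
    fun p => (abs_add_le _ _).trans (by
      linarith [norm_le_pi_norm g (degClass d G p.1), norm_le_pi_norm g (degClass d G p.2),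
        Real.norm_eq_abs (g (degClass d G p.1)), Real.norm_eq_abs (g (degClass d G p.2))])
  have hpos : (0 : ℝ) < (unsaturated d G).card := by exact_mod_cast (Nat.zero_le d).trans_lt hu
  simp only [Finset.sum_add_distrib, Finset.sum_const, sum_unsaturated hg, nsmul_eq_mul,
    ← Finset.mul_sum] at h
  convert! h using 1
  · congr 1
    rw [Finset.sum_add_distrib]
    field_simp
    ring
  · ring

/-- The mean over the eligible pairs of the square of the sum of a function of the degrees. -/
lemma abs_mean_sq_sub_le {G : SimpleGraph (Fin n)}
    (hu : d < (unsaturated d G).card) {g : Fin (d + 1) → ℝ} (hg : g (Fin.last d) = 0) :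
    |((eligible d G).card : ℝ)⁻¹ *
        ∑ p ∈ eligible d G, (g (degClass d G p.1) + g (degClass d G p.2)) ^ 2
      - (2 * total d G (fun k => g k ^ 2) / (unsaturated d G).card
        + 2 * (total d G g / (unsaturated d G).card) ^ 2)|
      ≤ 8 * d * ‖g‖ ^ 2 / (unsaturated d G).card := by
  have h := abs_mean_eligible_sub_le hu
    (f := fun p => (g (degClass d G p.1) + g (degClass d G p.2)) ^ 2) (B := (2 * ‖g‖) ^ 2)
    (by positivity)
    fun p => sq_le_of_abs_le ((abs_add_le _ _).trans (by
      linarith [norm_le_pi_norm g (degClass d G p.1), norm_le_pi_norm g (degClass d G p.2),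
        Real.norm_eq_abs (g (degClass d G p.1)), Real.norm_eq_abs (g (degClass d G p.2))]))
  have hpos : (0 : ℝ) < (unsaturated d G).card := by exact_mod_cast (Nat.zero_le d).trans_lt hu
  have hg2 : (fun k => g k ^ 2) (Fin.last d) = 0 := by simp [hg]
  have hs := sum_unsaturated (G := G) (g := fun k => g k ^ 2) hg2
  simp only [add_sq, Finset.sum_add_distrib, Finset.sum_const, sum_unsaturated hg, hs,
    nsmul_eq_mul, ← Finset.mul_sum, ← Finset.sum_mul] at h
  convert! h using 1
  · congr 1
    simp only [add_sq, Finset.sum_add_distrib]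
    field_simp
    ring
  · ring

lemma card_unsaturated_eq {G : SimpleGraph (Fin n)} (hG : ∀ v, G.degree v ≤ d) :
    ((unsaturated d G).card : ℝ) = n - degreeCounts d G (Fin.last d) := by
  have h := Finset.card_filter_add_card_filter_not (s := (Finset.univ : Finset (Fin n)))
    (fun v => G.degree v < d)
  rw [Finset.card_univ, Fintype.card_fin] at h
  have h2 : (Finset.univ.filter fun v => ¬ G.degree v < d)
      = Finset.univ.filter fun v => G.degree v = (Fin.last d : ℕ) := by
    ext v
    have := hG v
    simp only [Finset.mem_filter, Finset.mem_univ, true_and, Fin.val_last]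
    omega
  rw [h2] at h
  simp only [degreeCounts, unsaturated]
  rw [eq_sub_iff_add_eq]
  exact_mod_cast h

/-! ### Reachable graphs -/

/-- Each saturated vertex uses at least `d` of the degree sum `2m`. -/
lemma mul_card_unsaturated_ge {G : SimpleGraph (Fin n)} {m : ℕ}
    (hm : ∑ v, G.degree v = 2 * m) : d * n ≤ d * (unsaturated d G).card + 2 * m := by
  rw [← hm]
  have h : ∀ v, d ≤ (if G.degree v < d then d else 0) + G.degree v := fun v => by
    split_ifs <;> omega
  calc d * n = ∑ _v : Fin n, d := by simp [mul_comm]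
    _ ≤ ∑ v, ((if G.degree v < d then d else 0) + G.degree v) := Finset.sum_le_sum fun v _ => h v
    _ = _ := by
      rw [Finset.sum_add_distrib, ← Finset.sum_filter, Finset.sum_const, smul_eq_mul, mul_comm,
        unsaturated]

/-- In this range `u > d` before every step, so the process has not stopped and each step really
adds an edge. The `+ 1` is the exact slack: at `m + 1` the hypothesis reads `d² + 2m < dn`, which
excludes `u ≤ d` for a graph with `m` edges. -/
lemma mem_support_graphLaw {m : ℕ} (hm : d * d + 2 * m ≤ d * n + 1) {G : SimpleGraph (Fin n)}
    (hG : G ∈ (graphLaw d n m).support) : (∀ v, G.degree v ≤ d) ∧ ∑ v, G.degree v = 2 * m := by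
  induction m generalizing G with
  | zero =>
    simp only [graphLaw, PMF.support_pure, Set.mem_singleton_iff] at hG
    subst hG
    simp
  | succ m ih =>
    simp only [graphLaw, PMF.mem_support_bind_iff] at hG
    obtain ⟨H, hH, hG⟩ := hG
    obtain ⟨h1, h2⟩ := ih (by omega) hH
    have hu : d < (unsaturated d H).card := by
      have := mul_card_unsaturated_ge (d := d) h2
      by_contra hcon
      have : d * (unsaturated d H).card ≤ d * d := Nat.mul_le_mul_left d (not_lt.1 hcon)
      omega
    rw [step, dif_pos (eligible_nonempty hu), PMF.mem_support_map_iff] at hG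
    obtain ⟨p, hp, rfl⟩ := hG
    rw [PMF.mem_support_uniformOfFinset_iff] at hp
    obtain ⟨h3, h4, h5, h6⟩ := mem_eligible.1 hp
    refine ⟨fun v => ?_, ?_⟩
    · rw [degree_sup_edge h3 h4]
      split_ifs with h
      · rcases h with rfl | rfl <;> omega
      · exact h1 v
    · simp only [degree_sup_edge h3 h4, Finset.sum_add_distrib, h2]
      rw [← Finset.sum_filter, Finset.sum_const, Finset.filter_or, Finset.card_union_of_disjoint]
      · simp [Finset.filter_eq']
        omega
      · rw [Finset.disjoint_filter]
        rintro x - rfl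
        exact h3

end Step

/-! ### One-step estimates for the transported statistics -/

section OneStep

open scoped Classical

variable {d : ℕ} {γ : ℝ → EuclideanSpace ℝ (Fin (d + 1))} {T : ℝ} {s : ℝ → ℝ} {n : ℕ}

/-- The deviation of the degree counts from `n γ(t)`. -/
def deviation (γ : ℝ → EuclideanSpace ℝ (Fin (d + 1))) (t : ℝ) (G : SimpleGraph (Fin n)) :
    Fin (d + 1) → ℝ := (degreeCounts d G).ofLp - (n : ℝ) • (γ t).ofLp

/-- The pairing of the deviation with a transported test vector. -/
def statistic (s : ℝ → ℝ) (η : Fin (d + 1) → ℝ) (t : ℝ) (G : SimpleGraph (Fin n)) : ℝ :=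
  total d G (transport s η t) - n * η 0

/-- Graphs with bounded degrees and with a positive proportion of unsaturated vertices. -/
structure Regular (d : ℕ) (c : ℝ) (G : SimpleGraph (Fin n)) : Prop where
  degree_le : ∀ v, G.degree v ≤ d
  lt_card : d < (unsaturated d G).card
  le_card : c * n ≤ (unsaturated d G).card

lemma abs_dotProduct_le_norm (a b : Fin (d + 1) → ℝ) : |a ⬝ᵥ b| ≤ (d + 1) * (‖a‖ * ‖b‖) := by
  refine (Finset.abs_sum_le_sum_abs _ _).trans ?_
  refine (Finset.sum_le_card_nsmul _ _ (‖a‖ * ‖b‖) fun k _ => ?_).trans (by simp)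
  rw [abs_mul]
  exact mul_le_mul (norm_le_pi_norm a k) (norm_le_pi_norm b k) (abs_nonneg _) (norm_nonneg _)

lemma total_eq_dotProduct_deviation {G : SimpleGraph (Fin n)} (hG : ∀ v, G.degree v ≤ d) (t : ℝ)
    (a : Fin (d + 1) → ℝ) :
    total d G a = a ⬝ᵥ deviation γ t G + n * (a ⬝ᵥ (γ t).ofLp) := by
  rw [total_eq_sum_degreeCounts hG, deviation, dotProduct_sub, dotProduct_smul, smul_eq_mul]
  ring

lemma statistic_eq (hγ : IsSolution d γ) (hT : T < d / 2) (hs : IsClock γ T s)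
    {G : SimpleGraph (Fin n)} (hG : ∀ v, G.degree v ≤ d) {t : ℝ} (ht : t ∈ Set.Icc 0 T)
    (η : Fin (d + 1) → ℝ) : statistic s η t G = transport s η t ⬝ᵥ deviation γ t G := by
  rw [statistic, total_eq_dotProduct_deviation (γ := γ) hG t, hγ.transport_dotProduct hT hs η ht]
  ring

/-- Transport commutes with `D`, so `D a(t) · γ(t)` is constantly `(D η) 0 = 0`. The sum is thereby
of the order of the deviation instead of `n`. -/
lemma total_shiftDiff_transport (hγ : IsSolution d γ) (hT : T < d / 2) (hs : IsClock γ T s)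
    {G : SimpleGraph (Fin n)} (hG : ∀ v, G.degree v ≤ d) {t : ℝ} (ht : t ∈ Set.Icc 0 T)
    {η : Fin (d + 1) → ℝ} (hη : shiftDiff d η 0 = 0) :
    total d G (shiftDiff d (transport s η t))
      = shiftDiff d (transport s η t) ⬝ᵥ deviation γ t G := by
  rw [total_eq_dotProduct_deviation (γ := γ) hG t, ← shiftDiff_transport,
    hγ.transport_dotProduct hT hs _ ht, hη]
  ring

/-- The difference of the two denominators, `n (1 - γ_d) - u`, is exactly the last coordinate of the
deviation. -/
lemma abs_inv_sub_le {c u : ℝ} (hc : 0 < c) (hn : 0 < n) {G : SimpleGraph (Fin n)}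
    (hG : ∀ v, G.degree v ≤ d) (hu : u = (unsaturated d G).card) (hcu : c * n ≤ u) {t : ℝ}
    (h : c ≤ 1 - γ t (Fin.last d)) :
    |1 / u - 1 / (n * (1 - γ t (Fin.last d)))| ≤ ‖deviation γ t G‖ / (c ^ 2 * n ^ 2) := by
  have hn' : (0 : ℝ) < n := by exact_mod_cast hn
  have hu0 : 0 < u := (mul_pos hc hn').trans_le hcu
  have hh : 0 < 1 - γ t (Fin.last d) := hc.trans_le h
  have key : n * (1 - γ t (Fin.last d)) - u = deviation γ t G (Fin.last d) := by
    rw [hu, card_unsaturated_eq hG]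
    simp only [deviation, Pi.sub_apply, Pi.smul_apply, smul_eq_mul]
    ring
  have : 1 / u - 1 / (n * (1 - γ t (Fin.last d)))
      = deviation γ t G (Fin.last d) / (u * (n * (1 - γ t (Fin.last d)))) := by
    rw [← key]
    field_simp
  rw [this, abs_div, abs_of_pos (by positivity : 0 < u * (n * (1 - γ t (Fin.last d))))]
  refine div_le_div₀ (norm_nonneg _) (norm_le_pi_norm (deviation γ t G) _) (by positivity) ?_
  calc c ^ 2 * n ^ 2 = (c * n) * (n * c) := by ring
    _ ≤ u * (n * (1 - γ t (Fin.last d))) := by gcongr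

/-- The change of the statistic when `G` at time `x` is replaced by `G'` at time `y`. -/
def increment (s : ℝ → ℝ) (η : Fin (d + 1) → ℝ) (x y : ℝ) (G G' : SimpleGraph (Fin n)) : ℝ :=
  statistic s η y G' - statistic s η x G

lemma increment_sup_edge {η : Fin (d + 1) → ℝ} {x y : ℝ} {G : SimpleGraph (Fin n)}
    {p : Fin n × Fin n} (hp : p ∈ eligible d G) :
    increment s η x y G (G ⊔ SimpleGraph.edge p.1 p.2)
      = total d G (transport s η y - transport s η x)
        + (shiftDiff d (transport s η y) (degClass d G p.1)
          + shiftDiff d (transport s η y) (degClass d G p.2)) := by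
  rw [increment, statistic, statistic, total_sup_edge hp, total_sub]
  ring

variable {R K c : ℝ} {x y : ℝ} {η : Fin (d + 1) → ℝ} {G : SimpleGraph (Fin n)}

lemma TransportBounds.abs_add_shiftDiff_le (hb : TransportBounds γ T s R K) (hη : ‖η‖ ≤ R) {t : ℝ}
    (ht : t ∈ Set.Icc 0 T) (k l : Fin (d + 1)) :
    |shiftDiff d (transport s η t) k + shiftDiff d (transport s η t) l| ≤ 4 * K := by
  have h := (norm_shiftDiff_le (transport s η t)).trans
    (mul_le_mul_of_nonneg_left (hb.norm_le η hη t ht) zero_le_two)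
  have h1 := (norm_le_pi_norm (shiftDiff d (transport s η t)) k).trans h
  have h2 := (norm_le_pi_norm (shiftDiff d (transport s η t)) l).trans h
  rw [Real.norm_eq_abs] at h1 h2
  exact (abs_add_le _ _).trans (by linarith)

lemma TransportBounds.abs_total_sub_le (hb : TransportBounds γ T s R K) (hη : ‖η‖ ≤ R)
    (hn : 0 < n) (hx : 0 ≤ x) (hxy : y - x = 1 / n) (hy : y ≤ T) :
    |total d G (transport s η y - transport s η x)| ≤ K := by
  have hn' : (0 : ℝ) < n := by exact_mod_cast hn
  have hp : 0 < 1 / (n : ℝ) := by positivity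
  refine (abs_total_le _ _).trans ?_
  calc _ ≤ (n : ℝ) * (K * (1 / n)) := by
        rw [← hxy]
        exact mul_le_mul_of_nonneg_left (hb.norm_sub_le η hη x y hx (by linarith) hy) hn'.le
    _ = K := by field_simp

lemma TransportBounds.abs_increment_le (hb : TransportBounds γ T s R K) (hη : ‖η‖ ≤ R)
    (hn : 0 < n) (hx : 0 ≤ x) (hxy : y - x = 1 / n) (hy : y ≤ T)
    {p : Fin n × Fin n} (hp : p ∈ eligible d G) :
    |increment s η x y G (G ⊔ SimpleGraph.edge p.1 p.2)| ≤ 5 * K := by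
  have hp' : 0 < 1 / (n : ℝ) := by positivity
  rw [increment_sup_edge hp]
  refine (abs_add_le _ _).trans ?_
  linarith [hb.abs_total_sub_le (G := G) hη hn hx hxy hy,
    hb.abs_add_shiftDiff_le hη ⟨by linarith, hy⟩ (degClass d G p.1) (degClass d G p.2)]

lemma TransportBounds.abs_total_taylor_le (hb : TransportBounds γ T s R K) (hη : ‖η‖ ≤ R)
    (hn : 0 < n) (hx : 0 ≤ x) (hxy : y - x = 1 / n) (hy : y ≤ T) :
    |total d G (transport s η y - transport s η x)
      + 2 * total d G (shiftDiff d (transport s η x)) * (1 / (n * (1 - γ x (Fin.last d))))|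
      ≤ K / n := by
  have hn' : (0 : ℝ) < n := by exact_mod_cast hn
  have hp : 0 < 1 / (n : ℝ) := by positivity
  have h := hb.taylor η hη x y hx (by linarith) hy
  have h2 := abs_total_le G (transport s η y - transport s η x
      + ((y - x) * (2 / (1 - γ x (Fin.last d)))) • shiftDiff d (transport s η x))
  rw [total_add, total_smul] at h2
  calc _ = |total d G (transport s η y - transport s η x)
      + (y - x) * (2 / (1 - γ x (Fin.last d))) * total d G (shiftDiff d (transport s η x))| := by
        rw [hxy]
        congr 2
        simp only [div_eq_mul_inv, mul_inv]
        ring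
    _ ≤ n * (K * (y - x) ^ 2) := h2.trans (mul_le_mul_of_nonneg_left h hn'.le)
    _ = K / n := by
      rw [hxy]
      field_simp

lemma Regular.expect_step {E : Type*} [NormedAddCommGroup E] [NormedSpace ℝ E]
    (hG : Regular d c G) (f : SimpleGraph (Fin n) → E) :
    expect (step d G) f = ((eligible d G).card : ℝ)⁻¹ •
      ∑ p ∈ eligible d G, f (G ⊔ SimpleGraph.edge p.1 p.2) := DProc.expect_step hG.lt_card f

lemma Regular.abs_expect_increment_le_aux (hG : Regular d c G) (hc : 0 < c) (hK : 0 ≤ K)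
    (hb : TransportBounds γ T s R K) (hη : ‖η‖ ≤ R) (hn : 0 < n) (hx : 0 ≤ x)
    (hxy : y - x = 1 / n) (hy : y ≤ T) (hh : c ≤ 1 - γ x (Fin.last d)) :
    |expect (step d G) (increment s η x y G)| ≤
      2 * |total d G (shiftDiff d (transport s η x))| * (‖deviation γ x G‖ / (c ^ 2 * n ^ 2))
        + (K + 8 * d * K / c + 4 * K / c) / n := by
  have hn' : (0 : ℝ) < n := by exact_mod_cast hn
  have hp : 0 < 1 / (n : ℝ) := by positivity
  have hE : (0 : ℝ) < (eligible d G).card := by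
    exact_mod_cast (eligible_nonempty hG.lt_card).card_pos
  rw [hG.expect_step, smul_eq_mul, Finset.sum_congr rfl fun p hp => increment_sup_edge hp,
    Finset.sum_add_distrib, Finset.sum_const, nsmul_eq_mul, mul_add, ← mul_assoc,
    inv_mul_cancel₀ hE.ne', one_mul]
  have h1 := hb.abs_total_taylor_le (G := G) hη hn hx hxy hy
  have h2 := abs_mean_add_sub_le hG.lt_card (shiftDiff_last (transport s η y))
  have h3 : |total d G (shiftDiff d (transport s η y)) - total d G (shiftDiff d (transport s η x))|
      ≤ 2 * K := by
    rw [← total_sub, ← map_sub]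
    refine (abs_total_le _ _).trans ?_
    calc (n : ℝ) * ‖shiftDiff d (transport s η y - transport s η x)‖
        ≤ n * (2 * (K * (y - x))) := by
          refine mul_le_mul_of_nonneg_left ((norm_shiftDiff_le _).trans ?_) hn'.le
          linarith [hb.norm_sub_le η hη x y hx (by linarith) hy]
      _ = 2 * K := by
        rw [hxy]
        field_simp
  have h4 := abs_inv_sub_le (γ := γ) (t := x) hc hn hG.degree_le rfl hG.le_card hh
  have h5 := (norm_shiftDiff_le (transport s η y)).trans
    (mul_le_mul_of_nonneg_left (hb.norm_le η hη y ⟨by linarith, hy⟩) zero_le_two)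
  have hcu := hG.le_card
  set u : ℝ := ((unsaturated d G).card : ℝ)
  set m := ((eligible d G).card : ℝ)⁻¹ * ∑ p ∈ eligible d G,
    (shiftDiff d (transport s η y) (degClass d G p.1)
      + shiftDiff d (transport s η y) (degClass d G p.2))
  set τ := total d G (shiftDiff d (transport s η x))
  set τ' := total d G (shiftDiff d (transport s η y))
  set h := 1 - γ x (Fin.last d)
  have hu : 0 < u := (mul_pos hc hn').trans_le hcu
  -- Four errors: `1/u` against its deterministic value, the Taylor remainder of the transport that
  -- cancels the drift, the ineligible pairs, and the motion of `D a` between `x` and `y`. Only the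
  -- first involves the deviation.
  rw [show total d G (transport s η y - transport s η x) + m
      = 2 * τ * (1 / u - 1 / (n * h))
        + (total d G (transport s η y - transport s η x) + 2 * τ * (1 / (n * h)))
        + (m - 2 * τ' / u) + 2 * (τ' - τ) / u by ring]
  have e1 : |2 * τ * (1 / u - 1 / (n * h))| ≤ 2 * |τ| * (‖deviation γ x G‖ / (c ^ 2 * n ^ 2)) := by
    rw [abs_mul, abs_mul, abs_two]
    exact mul_le_mul_of_nonneg_left h4 (by positivity)
  have e2 : |m - 2 * τ' / u| ≤ 8 * d * K / c / n := by
    refine h2.trans ?_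
    calc _ ≤ 4 * d * (2 * K) / (c * n) := by gcongr
      _ = _ := by field_simp; ring
  have e3 : |2 * (τ' - τ) / u| ≤ 4 * K / c / n := by
    rw [abs_div, abs_of_pos hu, abs_mul, abs_two]
    calc _ ≤ 2 * (2 * K) / (c * n) := by gcongr
      _ = _ := by field_simp; ring
  have := abs_add_le (2 * τ * (1 / u - 1 / (n * h))
        + (total d G (transport s η y - transport s η x) + 2 * τ * (1 / (n * h)))
        + (m - 2 * τ' / u)) (2 * (τ' - τ) / u)
  have := abs_add_three (2 * τ * (1 / u - 1 / (n * h)))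
    (total d G (transport s η y - transport s η x) + 2 * τ * (1 / (n * h))) (m - 2 * τ' / u)
  rw [add_div, add_div]
  linarith

/-- The crude case `total (D a) = O(n)`: a drift linear in the deviation, good enough for Gronwall.
-/
lemma Regular.abs_expect_increment_le (hG : Regular d c G) (hc : 0 < c) (hK : 0 ≤ K)
    (hb : TransportBounds γ T s R K) (hη : ‖η‖ ≤ R) (hn : 0 < n) (hx : 0 ≤ x)
    (hxy : y - x = 1 / n) (hy : y ≤ T) (hh : c ≤ 1 - γ x (Fin.last d)) :
    |expect (step d G) (increment s η x y G)| ≤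
      (4 * K / c ^ 2 + (K + 8 * d * K / c + 4 * K / c)) * (‖deviation γ x G‖ + 1) / n := by
  have hn' : (0 : ℝ) < n := by exact_mod_cast hn
  have hp : 0 < 1 / (n : ℝ) := by positivity
  refine (hG.abs_expect_increment_le_aux hc hK hb hη hn hx hxy hy hh).trans ?_
  have h1 : |total d G (shiftDiff d (transport s η x))| ≤ n * (2 * K) :=
    (abs_total_le _ _).trans (mul_le_mul_of_nonneg_left ((norm_shiftDiff_le _).trans
      (mul_le_mul_of_nonneg_left (hb.norm_le η hη x ⟨hx, by linarith⟩) zero_le_two)) hn'.le)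
  set e := ‖deviation γ x G‖
  have he : 0 ≤ e := norm_nonneg _
  set B := K + 8 * d * K / c + 4 * K / c
  have hB : 0 ≤ B := by positivity
  calc _ ≤ 2 * (n * (2 * K)) * (e / (c ^ 2 * n ^ 2)) + B / n := by gcongr
    _ = (4 * K / c ^ 2 * e + B) / n := by field_simp; ring
    _ ≤ _ := by
      refine div_le_div_of_nonneg_right ?_ hn'.le
      have : 0 ≤ 4 * K / c ^ 2 := by positivity
      nlinarith [mul_nonneg hB he]

/-- Now both factors of the main error are of the order of the deviation, so the drift is
quadratically small. -/
lemma Regular.abs_expect_increment_le_of_shiftDiff_eq_zero (hγ : IsSolution d γ) (hT : T < d / 2)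
    (hs : IsClock γ T s) (hG : Regular d c G) (hc : 0 < c) (hK : 0 ≤ K)
    (hb : TransportBounds γ T s R K) (hη : ‖η‖ ≤ R) (hη0 : shiftDiff d η 0 = 0) (hn : 0 < n)
    (hx : 0 ≤ x) (hxy : y - x = 1 / n) (hy : y ≤ T) (hh : c ≤ 1 - γ x (Fin.last d)) :
    |expect (step d G) (increment s η x y G)| ≤
      4 * (d + 1) * K / c ^ 2 * (‖deviation γ x G‖ ^ 2 / n ^ 2)
        + (K + 8 * d * K / c + 4 * K / c) / n := by
  have hn' : (0 : ℝ) < n := by exact_mod_cast hn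
  have hp : 0 < 1 / (n : ℝ) := by positivity
  have hx' : x ∈ Set.Icc 0 T := ⟨hx, by linarith⟩
  refine (hG.abs_expect_increment_le_aux hc hK hb hη hn hx hxy hy hh).trans ?_
  have h1 : |total d G (shiftDiff d (transport s η x))|
      ≤ (d + 1) * (2 * K * ‖deviation γ x G‖) := by
    rw [total_shiftDiff_transport hγ hT hs hG.degree_le hx' hη0]
    refine (abs_dotProduct_le_norm _ _).trans ?_
    gcongr
    exact (norm_shiftDiff_le _).trans
      (mul_le_mul_of_nonneg_left (hb.norm_le η hη x hx') zero_le_two)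
  refine add_le_add_left ?_ _
  calc _ ≤ 2 * ((d + 1) * (2 * K * ‖deviation γ x G‖)) * (‖deviation γ x G‖ / (c ^ 2 * n ^ 2)) := by
        gcongr
    _ = _ := by field_simp; ring

-- Put `g = D a(x)` and let `e` be the norm of the deviation. As `total g = O(e)`, the transport
-- moves the statistic by only `O((e + 1)/n)`, and the increment is essentially `g` at the two
-- endpoints. Its mean square is nearly `2 ∑ g² / u + 2 (∑ g / u)²`; the first term approximates
-- `quadRate`, the second is negligible.
set_option maxHeartbeats 1000000 in
lemma Regular.abs_expect_sq_sub_rate_le (hγ : IsSolution d γ) (hT : T < d / 2)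
    (hs : IsClock γ T s) (hG : Regular d c G) (hc : 0 < c) (hK : 0 ≤ K)
    (hb : TransportBounds γ T s R K) (hη : ‖η‖ ≤ R) (hη0 : shiftDiff d η 0 = 0) (hn : 0 < n)
    (hx : 0 ≤ x) (hxy : y - x = 1 / n) (hy : y ≤ T) (hh : c ≤ 1 - γ x (Fin.last d)) :
    |expect (step d G) (fun G' => increment s η x y G G' ^ 2) - quadRate γ s η x| ≤
      (10 * K * (5 * K + 4 * (d + 1) * K / c) + 32 * d * K ^ 2 / c + 8 * (d + 1) * K ^ 2 / c ^ 2
        + 8 * (d + 1) * K ^ 2 / c + 8 * K ^ 2 / c ^ 2) * (‖deviation γ x G‖ + 1) / n := by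
  have hn' : (0 : ℝ) < n := by exact_mod_cast hn
  have hp : 0 < 1 / (n : ℝ) := by positivity
  have hx' : x ∈ Set.Icc 0 T := ⟨hx, by linarith⟩
  have hE : (0 : ℝ) < (eligible d G).card := by
    exact_mod_cast (eligible_nonempty hG.lt_card).card_pos
  have hg : ‖shiftDiff d (transport s η x)‖ ≤ 2 * K := (norm_shiftDiff_le _).trans
    (mul_le_mul_of_nonneg_left (hb.norm_le η hη x hx') zero_le_two)
  have hcu := hG.le_card
  have h4 := abs_inv_sub_le (γ := γ) (t := x) hc hn hG.degree_le rfl hcu hh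
  have h2 := abs_mean_sq_sub_le hG.lt_card (shiftDiff_last (transport s η x))
  have hτ1 : |total d G (shiftDiff d (transport s η x))| ≤ n * (2 * K) :=
    (abs_total_le _ _).trans (mul_le_mul_of_nonneg_left hg hn'.le)
  have hτ2 : |total d G (shiftDiff d (transport s η x))|
      ≤ (d + 1) * (2 * K * ‖deviation γ x G‖) := by
    rw [total_shiftDiff_transport hγ hT hs hG.degree_le hx' hη0]
    refine (abs_dotProduct_le_norm _ _).trans ?_
    gcongr
  have hsq : total d G (fun k => shiftDiff d (transport s η x) k ^ 2)
      = (fun k => shiftDiff d (transport s η x) k ^ 2) ⬝ᵥ deviation γ x G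
        + n * ((fun k => shiftDiff d (transport s η x) k ^ 2) ⬝ᵥ (γ x).ofLp) :=
    total_eq_dotProduct_deviation hG.degree_le x _
  have hsqn : ‖fun k => shiftDiff d (transport s η x) k ^ 2‖ ≤ (2 * K) ^ 2 :=
    (pi_norm_le_iff_of_nonneg (by positivity)).2 fun k =>
      sq_le_of_abs_le ((norm_le_pi_norm (shiftDiff d (transport s η x)) k).trans hg)
  have hv1 := (abs_dotProduct_le_norm (fun k => shiftDiff d (transport s η x) k ^ 2)
    (deviation γ x G)).trans (mul_le_mul_of_nonneg_left
      (mul_le_mul_of_nonneg_right hsqn (norm_nonneg _)) (by positivity))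
  have hv2 := hγ.abs_dotProduct_le hT hx' (fun k => shiftDiff d (transport s η x) k ^ 2)
    (fun k => (norm_le_pi_norm (fun k => shiftDiff d (transport s η x) k ^ 2) k).trans hsqn)
  have htay := hb.abs_total_taylor_le (G := G) hη hn hx hxy hy
  have hDlip : ‖shiftDiff d (transport s η y - transport s η x)‖ ≤ 2 * K / n := by
    refine (norm_shiftDiff_le _).trans ?_
    have := hb.norm_sub_le η hη x y hx (by linarith) hy
    rw [hxy] at this
    calc _ ≤ 2 * (K * (1 / n)) := by linarith
      _ = _ := by ring
  set e := ‖deviation γ x G‖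
  have he : 0 ≤ e := norm_nonneg _
  set h := 1 - γ x (Fin.last d)
  have hh0 : 0 < h := hc.trans_le hh
  set u : ℝ := ((unsaturated d G).card : ℝ)
  have hu : 0 < u := (mul_pos hc hn').trans_le hcu
  set τ := total d G (shiftDiff d (transport s η x))
  set g := shiftDiff d (transport s η x)
  have hpoint : ∀ p ∈ eligible d G,
      |increment s η x y G (G ⊔ SimpleGraph.edge p.1 p.2) ^ 2
        - (g (degClass d G p.1) + g (degClass d G p.2)) ^ 2|
      ≤ (5 * K + 4 * (d + 1) * K / c) * (e + 1) / n * (2 * (5 * K)) := fun p hp => by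
    refine abs_sq_sub_sq_le ?_ (hb.abs_increment_le hη hn hx hxy hy hp)
      ((hb.abs_add_shiftDiff_le hη hx' _ _).trans (by linarith))
    rw [increment_sup_edge hp]
    have hd1 := norm_le_pi_norm (shiftDiff d (transport s η y - transport s η x)) (degClass d G p.1)
    have hd2 := norm_le_pi_norm (shiftDiff d (transport s η y - transport s η x)) (degClass d G p.2)
    rw [map_sub, Pi.sub_apply, Real.norm_eq_abs] at hd1 hd2
    rw [map_sub] at hDlip
    have hτ3 : |2 * τ * (1 / (n * h))| ≤ 4 * (d + 1) * K / c * e / n := by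
      rw [abs_mul, abs_mul, abs_two, abs_of_pos (by positivity : 0 < 1 / (n * h))]
      calc _ ≤ 2 * ((d + 1) * (2 * K * e)) * (1 / (n * c)) := by gcongr
        _ = _ := by field_simp; ring
    set W := total d G (transport s η y - transport s η x)
    set g' := shiftDiff d (transport s η y)
    calc _ = |(W + 2 * τ * (1 / (n * h))) - 2 * τ * (1 / (n * h))
          + ((g' (degClass d G p.1) - g (degClass d G p.1))
            + (g' (degClass d G p.2) - g (degClass d G p.2)))| := by congr 1; ring
      _ ≤ (K / n + 4 * (d + 1) * K / c * e / n) + (2 * K / n + 2 * K / n) := by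
        refine (abs_add_le _ _).trans (add_le_add ((abs_sub _ _).trans (add_le_add htay hτ3))
          ((abs_add_le _ _).trans (add_le_add (hd1.trans hDlip) (hd2.trans hDlip))))
      _ = (5 * K + 4 * (d + 1) * K / c * e) / n := by ring
      _ ≤ _ := by
        refine div_le_div_of_nonneg_right ?_ hn'.le
        have : 0 ≤ 4 * (d + 1) * K / c := by positivity
        nlinarith [mul_nonneg hK he]
  have hmean : |expect (step d G) (fun G' => increment s η x y G G' ^ 2)
      - ((eligible d G).card : ℝ)⁻¹ *
        ∑ p ∈ eligible d G, (g (degClass d G p.1) + g (degClass d G p.2)) ^ 2|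
      ≤ (5 * K + 4 * (d + 1) * K / c) * (e + 1) / n * (2 * (5 * K)) := by
    rw [hG.expect_step, smul_eq_mul, ← mul_sub, ← Finset.sum_sub_distrib, abs_mul,
      abs_of_pos (inv_pos.2 hE), inv_mul_le_iff₀ hE]
    refine (Finset.abs_sum_le_sum_abs _ _).trans ?_
    simpa using Finset.sum_le_card_nsmul _ _ _ hpoint
  have hr4 : 8 * d * ‖g‖ ^ 2 / u ≤ 32 * d * K ^ 2 / c / n := by
    calc _ ≤ 8 * d * (2 * K) ^ 2 / (c * n) := by gcongr
      _ = _ := by field_simp; ring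
  -- One factor `τ` is bounded by `O(n)` and the other by `O(e)`, which makes the bound linear in
  -- `e`.
  have hτu : |2 * (τ / u) ^ 2| ≤ 8 * (d + 1) * K ^ 2 / c ^ 2 * e / n := by
    rw [abs_mul, abs_two, abs_pow, abs_div, abs_of_pos hu, div_pow, sq |τ|]
    calc _ ≤ 2 * (n * (2 * K) * ((d + 1) * (2 * K * e)) / (c * n) ^ 2) := by gcongr
      _ = _ := by field_simp; ring
  set V := (fun k => g k ^ 2) ⬝ᵥ deviation γ x G
  set Z := (fun k => g k ^ 2) ⬝ᵥ (γ x).ofLp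
  have hV : |2 * V / u| ≤ 8 * (d + 1) * K ^ 2 / c * e / n := by
    rw [abs_div, abs_mul, abs_two, abs_of_pos hu]
    calc _ ≤ 2 * ((d + 1) * ((2 * K) ^ 2 * e)) / (c * n) := by gcongr
      _ = _ := by field_simp; ring
  have hZ : |2 * n * Z * (1 / u - 1 / (n * h))| ≤ 8 * K ^ 2 / c ^ 2 * e / n := by
    rw [abs_mul, abs_mul, abs_mul, abs_two, abs_of_pos hn']
    calc _ ≤ 2 * n * (2 * K) ^ 2 * (e / (c ^ 2 * n ^ 2)) := by gcongr
      _ = _ := by field_simp; ring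
  have hrate : quadRate γ s η x = 2 * n * Z * (1 / (n * h)) := by
    rw [quadRate]
    change 2 / h * Z = _
    field_simp
  set X2 := expect (step d G) (fun G' => increment s η x y G G' ^ 2)
  set m := ((eligible d G).card : ℝ)⁻¹ *
        ∑ p ∈ eligible d G, (g (degClass d G p.1) + g (degClass d G p.2)) ^ 2
  rw [hsq] at h2
  rw [show X2 - quadRate γ s η x = (X2 - m)
      + (m - (2 * (V + n * Z) / u + 2 * (τ / u) ^ 2))
      + 2 * (τ / u) ^ 2 + 2 * V / u + 2 * n * Z * (1 / u - 1 / (n * h)) by rw [hrate]; ring]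
  have t1 := abs_add_le ((X2 - m) + (m - (2 * (V + n * Z) / u + 2 * (τ / u) ^ 2))
      + 2 * (τ / u) ^ 2 + 2 * V / u) (2 * n * Z * (1 / u - 1 / (n * h)))
  have t2 := abs_add_le ((X2 - m) + (m - (2 * (V + n * Z) / u + 2 * (τ / u) ^ 2))
      + 2 * (τ / u) ^ 2) (2 * V / u)
  have t3 := abs_add_three (X2 - m) (m - (2 * (V + n * Z) / u + 2 * (τ / u) ^ 2)) (2 * (τ / u) ^ 2)
  have hle : ∀ A : ℝ, 0 ≤ A → A * e / n ≤ A * (e + 1) / n := fun A hA =>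
    div_le_div_of_nonneg_right (by linarith) hn'.le
  have hle' : ∀ A : ℝ, 0 ≤ A → A / n ≤ A * (e + 1) / n := fun A hA =>
    div_le_div_of_nonneg_right (by nlinarith) hn'.le
  have f1 := hle' (32 * d * K ^ 2 / c) (by positivity)
  have f2 := hle (8 * (d + 1) * K ^ 2 / c ^ 2) (by positivity)
  have f3 := hle (8 * (d + 1) * K ^ 2 / c) (by positivity)
  have f4 := hle (8 * K ^ 2 / c ^ 2) (by positivity)
  calc _ ≤ (5 * K + 4 * (d + 1) * K / c) * (e + 1) / n * (2 * (5 * K))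
      + 32 * d * K ^ 2 / c * (e + 1) / n + 8 * (d + 1) * K ^ 2 / c ^ 2 * (e + 1) / n
      + 8 * (d + 1) * K ^ 2 / c * (e + 1) / n + 8 * K ^ 2 / c ^ 2 * (e + 1) / n := by linarith
    _ = _ := by ring

end OneStep

/-! ### Moment estimates along the process -/

section Moments

open scoped Classical

variable {d : ℕ} {γ : ℝ → EuclideanSpace ℝ (Fin (d + 1))} {T : ℝ} {s : ℝ → ℝ} {n : ℕ}

lemma one_sub_pos (hd : 0 < d) (hT : T < d / 2) : 0 < 1 - 2 * T / d := by
  have hd' : (0 : ℝ) < d := by exact_mod_cast hd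
  rw [sub_pos, div_lt_one hd']
  linarith

lemma degree_le_of_mem_support (hd : 0 < d) (hn : (d : ℝ) < (1 - 2 * T / d) * n) {j : ℕ}
    (hj : (j : ℝ) ≤ T * n) {G : SimpleGraph (Fin n)} (hG : G ∈ (graphLaw d n j).support) :
    (∀ v, G.degree v ≤ d) ∧ ∑ v, G.degree v = 2 * j := by
  have hd' : (0 : ℝ) < d := by exact_mod_cast hd
  have h1 : (d : ℝ) * d + 2 * j ≤ d * n := by
    have h2 : (d : ℝ) * d ≤ d * ((1 - 2 * T / d) * n) := mul_le_mul_of_nonneg_left hn.le hd'.le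
    have h3 : (d : ℝ) * ((1 - 2 * T / d) * n) = d * n - 2 * (T * n) := by field_simp
    linarith
  have h2 : d * d + 2 * j ≤ d * n := by exact_mod_cast h1
  exact mem_support_graphLaw (by omega) hG

lemma regular_of_mem_support (hd : 0 < d) (hn : (d : ℝ) < (1 - 2 * T / d) * n) {j : ℕ}
    (hj : (j : ℝ) ≤ T * n) {G : SimpleGraph (Fin n)} (hG : G ∈ (graphLaw d n j).support) :
    Regular d (1 - 2 * T / d) G := by
  have hd' : (0 : ℝ) < d := by exact_mod_cast hd
  obtain ⟨h1, h2⟩ := degree_le_of_mem_support hd hn hj hG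
  have h3 : (d * n : ℝ) ≤ d * (unsaturated d G).card + 2 * j := by
    exact_mod_cast mul_card_unsaturated_ge (d := d) h2
  have h4 : (1 - 2 * T / d) * n ≤ (unsaturated d G).card := by
    refine le_of_mul_le_mul_left ?_ hd'
    have h5 : (d : ℝ) * ((1 - 2 * T / d) * n) = d * n - 2 * (T * n) := by field_simp
    linarith
  exact ⟨h1, by exact_mod_cast hn.trans_le h4, h4⟩

lemma Regular.exists_of_mem_support_step {c : ℝ} {G G' : SimpleGraph (Fin n)}
    (hG : Regular d c G) (h : G' ∈ (step d G).support) :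
    ∃ p ∈ eligible d G, G' = G ⊔ SimpleGraph.edge p.1 p.2 := by
  rw [step, dif_pos (eligible_nonempty hG.lt_card), PMF.mem_support_map_iff] at h
  obtain ⟨p, hp, rfl⟩ := h
  exact ⟨p, (PMF.mem_support_uniformOfFinset_iff _ _).1 hp, rfl⟩

/-- Discrete Gronwall: inductively `x j ≤ C j (1 + C/n)^j`, and `(1 + C/n)^j ≤ exp(C j/n) ≤ exp(C
T)`. -/
lemma le_of_recurrence {C T : ℝ} (hC : 0 ≤ C) (hn : 0 < n) {x : ℕ → ℝ} (h0 : x 0 = 0)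
    (h : ∀ j : ℕ, ((j + 1 : ℕ) : ℝ) ≤ T * n → x (j + 1) ≤ (1 + C / n) * x j + C) (j : ℕ)
    (hj : (j : ℝ) ≤ T * n) : x j ≤ C * T * Real.exp (C * T) * n := by
  have hn' : (0 : ℝ) < n := by exact_mod_cast hn
  have key : ∀ j : ℕ, (j : ℝ) ≤ T * n → x j ≤ C * j * (1 + C / n) ^ j := by
    intro j
    induction j with
    | zero => simp [h0]
    | succ j ih =>
      intro hj
      have ih' := ih (by push_cast at hj; linarith)
      have h1 : (1 : ℝ) ≤ 1 + C / n := by linarith [div_nonneg hC hn'.le]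
      have h2 : (1 : ℝ) ≤ (1 + C / n) ^ (j + 1) := one_le_pow₀ h1
      calc x (j + 1) ≤ (1 + C / n) * x j + C := h j hj
        _ ≤ (1 + C / n) * (C * j * (1 + C / n) ^ j) + C * (1 + C / n) ^ (j + 1) := by
          gcongr
          exact le_mul_of_one_le_right hC h2
        _ = _ := by push_cast; ring
  refine (key j hj).trans ?_
  have hjn : (j : ℝ) / n ≤ T := by rwa [div_le_iff₀ hn']
  have h1 : (1 + C / n) ^ j ≤ Real.exp (C * T) := by
    calc (1 + C / n) ^ j ≤ Real.exp (C / n) ^ j := by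
          gcongr
          linarith [Real.add_one_le_exp (C / n)]
      _ = Real.exp (C * (j / n)) := by
        rw [← Real.exp_nat_mul]
        congr 1
        ring
      _ ≤ _ := by gcongr
  have hTn : 0 ≤ T * n := (Nat.cast_nonneg j).trans hj
  calc C * j * (1 + C / n) ^ j ≤ C * (T * n) * Real.exp (C * T) := by gcongr
    _ = _ := by ring

lemma statistic_sum (w : Fin (d + 1) → ℝ) (t : ℝ) (G : SimpleGraph (Fin n)) :
    statistic s w t G = ∑ i, w i * statistic s (Pi.single i 1) t G := by
  have h : w = ∑ i, w i • (Pi.single i 1 : Fin (d + 1) → ℝ) := by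
    ext k
    simp [Finset.sum_apply, Pi.single_apply]
  have h1 : transport s w t = ∑ i, w i • transport s (Pi.single i 1) t := by
    conv_lhs => rw [transport, h, map_sum]
    simp only [map_smul]
    rfl
  have h2 : total d G (transport s w t) = ∑ i, w i * total d G (transport s (Pi.single i 1) t) := by
    rw [h1]
    simp only [total, Finset.sum_apply, Pi.smul_apply, smul_eq_mul, Finset.mul_sum]
    exact Finset.sum_comm
  rw [statistic, h2]
  simp only [statistic, mul_sub, Finset.sum_sub_distrib]
  congr 1
  simp [Pi.single_apply]
  ring

lemma norm_single_le (i : Fin (d + 1)) : ‖(Pi.single i 1 : Fin (d + 1) → ℝ)‖ ≤ 1 := by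
  rw [pi_norm_le_iff_of_nonneg zero_le_one]
  intro k
  by_cases h : k = i
  · subst h
    simp
  · simp [h]

/-- Coordinate `k` of the deviation is the statistic of `flow d (s t)` applied to the `k`-th unit
vector, whose transport to time `t` is that unit vector. Expanding in the unit vectors at time `0`
and applying Cauchy–Schwarz gives the bound. -/
lemma sq_norm_deviation_le (hγ : IsSolution d γ) (hT : T < d / 2) (hs : IsClock γ T s)
    {P : ℝ} (hP : ∀ t ∈ Set.Icc 0 T, ‖flow d (s t)‖ ≤ P) {G : SimpleGraph (Fin n)}
    (hG : ∀ v, G.degree v ≤ d) {t : ℝ} (ht : t ∈ Set.Icc 0 T) :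
    ‖deviation γ t G‖ ^ 2 ≤
    (d + 1) * P ^ 2 * ∑ i : Fin (d + 1), statistic s (Pi.single i 1 : Fin (d + 1) → ℝ) t G ^ 2 := by
  have hP0 : 0 ≤ P := (norm_nonneg _).trans (hP t ht)
  set B := (d + 1) * P ^ 2 *
    ∑ i : Fin (d + 1), statistic s (Pi.single i 1 : Fin (d + 1) → ℝ) t G ^ 2 with hB
  have hB0 : 0 ≤ B := by positivity
  have h : ‖deviation γ t G‖ ≤ √B := by
    refine (pi_norm_le_iff_of_nonneg (Real.sqrt_nonneg _)).2 fun k => Real.abs_le_sqrt ?_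
    have h1 : deviation γ t G k = statistic s (flow d (s t) (Pi.single k 1)) t G := by
      rw [statistic_eq hγ hT hs hG ht, transport_flow, single_dotProduct, one_mul]
    rw [h1, statistic_sum]
    refine (Finset.sum_mul_sq_le_sq_mul_sq _ _ _).trans ?_
    refine mul_le_mul_of_nonneg_right ?_ (Finset.sum_nonneg fun _ _ => sq_nonneg _)
    refine (Finset.sum_le_card_nsmul _ _ (P ^ 2) fun i _ => ?_).trans (by simp)
    have h2 : |flow d (s t) (Pi.single k 1) i| ≤ P :=
      (norm_le_pi_norm (flow d (s t) (Pi.single k 1)) i).trans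
        (((flow d (s t)).le_opNorm _).trans
          ((mul_le_mul (hP t ht) (norm_single_le k) (norm_nonneg _) hP0).trans (by simp)))
    exact (le_abs_self _).trans (sq_le_of_abs_le h2)
  calc _ ≤ √B ^ 2 := pow_le_pow_left₀ (norm_nonneg _) h 2
    _ = B := Real.sq_sqrt hB0

lemma statistic_succ (η : Fin (d + 1) → ℝ) (x y : ℝ) (G G' : SimpleGraph (Fin n)) :
    statistic s η y G' = statistic s η x G + increment s η x y G G' := by
  rw [increment]
  ring

lemma succ_div_sub (n j : ℕ) : ((j + 1 : ℕ) : ℝ) / n - (j : ℝ) / n = 1 / n := by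
  push_cast
  ring

-- The sum `S` of the squared statistics of the unit vectors satisfies `E S_{j+1} ≤ (1 + C/n) E S_j
-- + C`: bounded increments give the constant, and the drift, at most linear in the deviation, gives
-- the factor.
set_option maxHeartbeats 1000000 in
lemma exists_second_moment_le (hγ : IsSolution d γ) (hd : 0 < d) (hT0 : 0 ≤ T) (hT : T < d / 2)
    (hs : IsClock γ T s) : ∃ C, 0 ≤ C ∧ ∀ n : ℕ, (d : ℝ) < (1 - 2 * T / d) * n → ∀ j : ℕ,
      (j : ℝ) ≤ T * n →
      expect (graphLaw d n j) (fun G => ‖deviation γ ((j : ℝ) / n) G‖ ^ 2) ≤ C * n := by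
  obtain ⟨K, hK1, hb⟩ := hγ.exists_transportBounds hd hT hs (R := 1) zero_le_one
  obtain ⟨P, hP0, hP⟩ := hs.exists_norm_flow_le
  have hc := one_sub_pos hd hT
  set c := 1 - 2 * T / d
  have hK : 0 ≤ K := by linarith
  set D := 4 * K / c ^ 2 + (K + 8 * d * K / c + 4 * K / c)
  have hD : 0 ≤ D := by positivity
  set L := (d + 1) * P ^ 2
  have hL : 0 ≤ L := by positivity
  set N : ℝ := d + 1
  have hN : 0 ≤ N := by positivity
  set C := N * (2 * (N * K) * D * (2 * L)) + N * (2 * (N * K) * D + (5 * K) ^ 2)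
  have hC : 0 ≤ C := by positivity
  refine ⟨L * (C * T * Real.exp (C * T)), by positivity, fun n hn j hj => ?_⟩
  have hn0 : 0 < n := by
    rcases Nat.eq_zero_or_pos n with rfl | h
    · simp only [Nat.cast_zero, mul_zero] at hn
      exact absurd hn (not_lt.2 (Nat.cast_nonneg d))
    · exact h
  have hn' : (0 : ℝ) < n := by exact_mod_cast hn0
  have hn1 : (1 : ℝ) ≤ n := by exact_mod_cast hn0
  set S : ℕ → SimpleGraph (Fin n) → ℝ := fun j G =>
    ∑ i : Fin (d + 1), statistic s (Pi.single i 1) ((j : ℝ) / n) G ^ 2 with hS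
  have hmem : ∀ j : ℕ, (j : ℝ) ≤ T * n → (j : ℝ) / n ∈ Set.Icc 0 T := fun j hj =>
    ⟨by positivity, by rwa [div_le_iff₀ hn']⟩
  have hdev : ∀ j : ℕ, (j : ℝ) ≤ T * n → ∀ G ∈ (graphLaw d n j).support,
      ‖deviation γ ((j : ℝ) / n) G‖ ^ 2 ≤ L * S j G := fun j hj G hG =>
    sq_norm_deviation_le hγ hT hs (fun t ht => (hP t ht).1)
      (degree_le_of_mem_support hd hn hj hG).1 (hmem j hj)
  have hrec : ∀ j : ℕ, ((j + 1 : ℕ) : ℝ) ≤ T * n → expect (graphLaw d n (j + 1)) (S (j + 1))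
      ≤ (1 + C / n) * expect (graphLaw d n j) (S j) + C := by
    intro j hj1
    have hj : (j : ℝ) ≤ T * n := by push_cast at hj1; linarith
    rw [graphLaw, expect_bind]
    refine (expect_mono (g := fun G => (1 + C / n) * S j G + C) fun G hG => ?_).trans_eq
      (by rw [expect_add, expect_const_mul, expect_const])
    have hreg := regular_of_mem_support hd hn hj hG
    have hh := hγ.one_sub_last_ge hd hT (hmem j hj)
    set x := (j : ℝ) / n
    set y := ((j + 1 : ℕ) : ℝ) / n
    have hxy : y - x = 1 / n := succ_div_sub n j
    set e := ‖deviation γ x G‖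
    have he : 0 ≤ e := norm_nonneg _
    have he2 : e * (e + 1) ≤ 2 * (L * S j G) + 1 := by nlinarith [hdev j hj G hG, sq_nonneg (e - 1)]
    have hterm : ∀ i : Fin (d + 1), expect (step d G) (fun G' => statistic s (Pi.single i 1) y G' ^ 2)
        ≤ statistic s (Pi.single i 1) x G ^ 2
          + (2 * (N * K) * D * (2 * L * S j G + 1) / n + (5 * K) ^ 2) := by
      intro i
      set Y := statistic s (Pi.single i 1) x G
      have hY : |Y| ≤ N * K * e := by
        rw [show Y = _ from statistic_eq hγ hT hs hreg.degree_le (hmem j hj) _]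
        refine (abs_dotProduct_le_norm _ _).trans ?_
        rw [mul_assoc]
        gcongr
        exact hb.norm_le _ (norm_single_le i) x (hmem j hj)
      have h1 := hreg.abs_expect_increment_le hc hK hb (norm_single_le i) hn0 (hmem j hj).1 hxy
        (hmem _ hj1).2 hh
      have h2 : expect (step d G) (fun G' => increment s (Pi.single i 1) x y G G' ^ 2)
          ≤ (5 * K) ^ 2 := by
        rw [← expect_const (step d G) ((5 * K) ^ 2)]
        refine expect_mono fun G' hG' => ?_
        obtain ⟨p, hp, rfl⟩ := hreg.exists_of_mem_support_step hG'
        exact (le_abs_self _).trans (sq_le_of_abs_le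
          (hb.abs_increment_le (norm_single_le i) hn0 (hmem j hj).1 hxy (hmem _ hj1).2 hp))
      have h3 : expect (step d G) (fun G' => statistic s (Pi.single i 1) y G' ^ 2)
          = Y ^ 2 + (2 * Y * expect (step d G) (increment s (Pi.single i 1) x y G)
            + expect (step d G) (fun G' => increment s (Pi.single i 1) x y G G' ^ 2)) := by
        rw [← expect_const (step d G) (Y ^ 2), ← expect_const_mul, ← expect_add, ← expect_add]
        refine expect_congr fun G' _ => ?_
        rw [statistic_succ _ x y G G']
        ring
      rw [h3]
      refine add_le_add_right (add_le_add ?_ h2) _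
      calc 2 * Y * expect (step d G) (increment s (Pi.single i 1) x y G)
          ≤ |2 * Y * expect (step d G) (increment s (Pi.single i 1) x y G)| := le_abs_self _
        _ = 2 * |Y| * |expect (step d G) (increment s (Pi.single i 1) x y G)| := by
          rw [abs_mul, abs_mul, abs_two]
        _ ≤ 2 * (N * K * e) * (D * (e + 1) / n) := by gcongr
        _ = 2 * (N * K) * D * (e * (e + 1)) / n := by ring
        _ ≤ _ := by
          gcongr
          linarith
    simp only [hS]
    rw [expect_sum]
    refine (Finset.sum_le_sum fun i _ => hterm i).trans ?_
    rw [Finset.sum_add_distrib, Finset.sum_const, Finset.card_univ, Fintype.card_fin, nsmul_eq_mul]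
    have hSnn : 0 ≤ S j G := Finset.sum_nonneg fun _ _ => sq_nonneg _
    rw [show ∑ i : Fin (d + 1), statistic s (Pi.single i 1) x G ^ 2 = S j G from rfl]
    push_cast
    change S j G + N * _ ≤ _
    have h5 : N * (2 * (N * K) * D) / n ≤ N * (2 * (N * K) * D) :=
      div_le_self (by positivity) hn1
    have h6 : 0 ≤ N * (2 * (N * K) * D + (5 * K) ^ 2) / n * S j G := by positivity
    have h7 : 0 ≤ N * (2 * (N * K) * D * (2 * L)) := by positivity
    calc S j G + N * (2 * (N * K) * D * (2 * L * S j G + 1) / n + (5 * K) ^ 2)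
        = S j G + N * (2 * (N * K) * D * (2 * L)) / n * S j G + N * (2 * (N * K) * D) / n
          + N * (5 * K) ^ 2 := by ring
      _ ≤ S j G + (N * (2 * (N * K) * D * (2 * L)) / n * S j G
          + N * (2 * (N * K) * D + (5 * K) ^ 2) / n * S j G) + N * (2 * (N * K) * D)
          + N * (5 * K) ^ 2 + N * (2 * (N * K) * D * (2 * L)) := by linarith
      _ = _ := by ring
  have h0 : expect (graphLaw d n 0) (S 0) = 0 := by
    rw [graphLaw, expect_pure]
    refine Finset.sum_eq_zero fun i _ => ?_
    have : (Nat.cast 0 : ℝ) / n = 0 := by simp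
    rw [this, statistic, hs.transport_zero]
    simp [total, degClass, show ((⟨0, by omega⟩ : Fin (d + 1))) = 0 from rfl]
  calc expect (graphLaw d n j) (fun G => ‖deviation γ ((j : ℝ) / n) G‖ ^ 2)
      ≤ expect (graphLaw d n j) (fun G => L * S j G) := expect_mono (hdev j hj)
    _ = L * expect (graphLaw d n j) (S j) := expect_const_mul _ _ _
    _ ≤ L * (C * T * Real.exp (C * T) * n) := by
      gcongr
      exact le_of_recurrence (x := fun j => expect (graphLaw d n j) (S j)) hC hn0 h0 hrec j hj
    _ = _ := by ring

/-! ### Characteristic functions -/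

/-- Taylor expansion of the exponential to second order. In the application `r = √n`, `A₁` bounds
the drift, `A₂` the error of the conditional variance, and `B` the increments. -/
lemma norm_expect_cexp_sub_le {α : Type*} [Fintype α] (p : PMF α) {X : α → ℝ} {B r q A₁ A₂ : ℝ}
    (hr : 1 ≤ r) (hX : ∀ a ∈ p.support, |X a| ≤ B) (h1 : |expect p X| ≤ A₁)
    (h2 : |expect p (fun a => X a ^ 2) - q| ≤ A₂) :
    ‖expect p (fun a => Complex.exp (Complex.I * (X a / r : ℝ))) - (1 - q / (2 * r ^ 2) : ℝ)‖
      ≤ A₁ / r + A₂ / (2 * r ^ 2) + B ^ 3 * Real.exp B / r ^ 3 := by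
  have hr0 : 0 < r := by linarith
  have hmain : ∀ a ∈ p.support, ‖Complex.exp (Complex.I * (X a / r : ℝ))
      - (((1 - X a ^ 2 / (2 * r ^ 2) : ℝ) : ℂ) + ((X a / r : ℝ) : ℂ) * Complex.I)‖
      ≤ B ^ 3 * Real.exp B / r ^ 3 := by
    intro a ha
    have h := Complex.norm_exp_sub_sum_le_norm_mul_exp (Complex.I * (X a / r : ℝ)) 3
    have hn : ‖Complex.I * ((X a / r : ℝ) : ℂ)‖ = |X a| / r := by
      rw [norm_mul, Complex.norm_I, one_mul, Complex.norm_real, Real.norm_eq_abs, abs_div,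
        abs_of_pos hr0]
    rw [hn] at h
    have hXB := hX a ha
    have hB : 0 ≤ B := (abs_nonneg _).trans hXB
    have hXr : |X a| / r ≤ B := (div_le_self (abs_nonneg _) hr).trans hXB
    refine (le_of_eq ?_).trans (h.trans ?_)
    · congr 2
      simp only [Finset.sum_range_succ, Finset.sum_range_zero, Nat.factorial]
      push_cast
      rw [pow_zero, pow_one, mul_pow, Complex.I_sq]
      field_simp
      ring
    · calc (|X a| / r) ^ 3 * Real.exp (|X a| / r) ≤ (B / r) ^ 3 * Real.exp B := by gcongr
        _ = _ := by ring
  have hA : expect p (fun a => ((1 - X a ^ 2 / (2 * r ^ 2) : ℝ) : ℂ)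
      + ((X a / r : ℝ) : ℂ) * Complex.I) - (1 - q / (2 * r ^ 2) : ℝ)
      = ((-((expect p (fun a => X a ^ 2) - q) / (2 * r ^ 2)) : ℝ) : ℂ)
        + ((expect p X / r : ℝ) : ℂ) * Complex.I := by
    have e1 : expect p (fun a => 1 - X a ^ 2 / (2 * r ^ 2))
        = 1 - expect p (fun a => X a ^ 2) / (2 * r ^ 2) := by
      rw [expect_sub, expect_const, div_eq_inv_mul, ← expect_const_mul]
      simp only [div_eq_inv_mul]
    have e2 : expect p (fun a => X a / r) = expect p X / r := by
      rw [div_eq_inv_mul, ← expect_const_mul]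
      simp only [div_eq_inv_mul]
    rw [expect_add, expect_mul_const_complex, expect_ofReal, expect_ofReal, e1, e2]
    push_cast
    ring
  have hB := norm_expect_le_of_le hmain
  rw [expect_sub, expect_const] at hB
  have hC : ‖((-((expect p (fun a => X a ^ 2) - q) / (2 * r ^ 2)) : ℝ) : ℂ)
        + ((expect p X / r : ℝ) : ℂ) * Complex.I‖ ≤ A₂ / (2 * r ^ 2) + A₁ / r := by
    refine (norm_add_le _ _).trans ?_
    rw [norm_mul, Complex.norm_I, mul_one, Complex.norm_real, Complex.norm_real, norm_neg,
      Real.norm_eq_abs, Real.norm_eq_abs, abs_div, abs_div, abs_of_pos hr0,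
      abs_of_pos (by positivity : 0 < 2 * r ^ 2)]
    gcongr
  rw [← hA] at hC
  calc _ = ‖(expect p (fun a => Complex.exp (Complex.I * (X a / r : ℝ)))
        - expect p (fun a => ((1 - X a ^ 2 / (2 * r ^ 2) : ℝ) : ℂ)
          + ((X a / r : ℝ) : ℂ) * Complex.I))
        + (expect p (fun a => ((1 - X a ^ 2 / (2 * r ^ 2) : ℝ) : ℂ)
          + ((X a / r : ℝ) : ℂ) * Complex.I) - (1 - q / (2 * r ^ 2) : ℝ))‖ := by congr 1; ring
    _ ≤ _ := by
      refine (norm_add_le _ _).trans ?_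
      linarith

/-- One step of the Gaussian factor, expanded to match the main term of `norm_expect_cexp_sub_le` at
`r = √n`. -/
lemma abs_exp_neg_half_sub_le {Δ q K n : ℝ} (hn : 1 ≤ n) (hq : |q| ≤ K)
    (hΔ : |Δ - 1 / n * q| ≤ K * (1 / n) ^ 2) :
    |Real.exp (-(Δ / 2)) - (1 - q / (2 * n))| ≤ (K ^ 2 * Real.exp K + K) / n ^ 2 := by
  have hn0 : 0 < n := by linarith
  have hK : 0 ≤ K := (abs_nonneg _).trans hq
  have hqn : |1 / n * q| ≤ K / n := by
    rw [abs_mul, abs_of_pos (by positivity : 0 < 1 / n)]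
    calc _ ≤ 1 / n * K := by gcongr
      _ = _ := by ring
  have hKn : K * (1 / n) ^ 2 ≤ K / n := by
    rw [one_div, div_eq_mul_inv]
    refine mul_le_mul_of_nonneg_left ?_ hK
    exact pow_le_of_le_one (by positivity) (inv_le_one_of_one_le₀ hn) two_ne_zero
  have hΔ2 : |Δ| ≤ 2 * (K / n) := by
    have := abs_add_le (Δ - 1 / n * q) (1 / n * q)
    rw [sub_add_cancel] at this
    linarith
  set z := -(Δ / 2)
  have hz : |z| ≤ K / n := by
    rw [abs_neg, abs_div, abs_two]
    linarith
  have hzK : |z| ≤ K := hz.trans (div_le_self hK hn)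
  have h := Complex.norm_exp_sub_sum_le_norm_mul_exp (z : ℂ) 2
  simp only [Finset.sum_range_succ, Finset.sum_range_zero, Nat.factorial] at h
  have h' : |Real.exp z - (1 + z)| ≤ (K / n) ^ 2 * Real.exp K := by
    refine (le_of_eq ?_).trans (h.trans ?_)
    · rw [← Real.norm_eq_abs, ← Complex.norm_real]
      congr 1
      push_cast
      ring
    · rw [Complex.norm_real, Real.norm_eq_abs]
      gcongr
  calc _ = |(Real.exp z - (1 + z)) - (Δ - 1 / n * q) / 2| := by
        congr 1
        simp only [z]
        field_simp
        ring
    _ ≤ |Real.exp z - (1 + z)| + |(Δ - 1 / n * q) / 2| := abs_sub _ _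
    _ ≤ (K / n) ^ 2 * Real.exp K + K * (1 / n) ^ 2 := by
      refine add_le_add h' ?_
      rw [abs_div, abs_two]
      have : 0 ≤ K * (1 / n) ^ 2 := by positivity
      linarith
    _ = _ := by ring

-- The compensated function `Ψ j = E exp(i Y_j/√n) · exp(Q_j/2)` starts at `1`. Each step changes it
-- by `O(n^{-3/2})`, once the second moment bound controls the mean of `e²/n`; at most `Tn` steps
-- accumulate `O(n^{-1/2})`.
set_option maxHeartbeats 1000000 in
lemma exists_charFun_bound (hγ : IsSolution d γ) (hd : 0 < d) (hT0 : 0 ≤ T) (hT : T < d / 2)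
    (hs : IsClock γ T s) {R : ℝ} (hR : 0 ≤ R) : ∃ C, 0 ≤ C ∧ ∀ n : ℕ,
      (d : ℝ) < (1 - 2 * T / d) * n → ∀ η : Fin (d + 1) → ℝ, ‖η‖ ≤ R → shiftDiff d η 0 = 0 →
      ∀ j : ℕ, (j : ℝ) ≤ T * n →
      ‖expect (graphLaw d n j) (fun G =>
          Complex.exp (Complex.I * (statistic s η ((j : ℝ) / n) G / √n : ℝ)))
        - (Real.exp (-(quadVar γ s η ((j : ℝ) / n) / 2)) : ℝ)‖ ≤ C / √n := by
  obtain ⟨K, hK1, hb⟩ := hγ.exists_transportBounds hd hT hs hR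
  obtain ⟨M, hM0, hM⟩ := exists_second_moment_le hγ hd hT0 hT hs
  have hc := one_sub_pos hd hT
  set c := 1 - 2 * T / d
  have hK : 0 ≤ K := by linarith
  set A₁ := 4 * (d + 1) * K / c ^ 2
  have hA₁ : 0 ≤ A₁ := by positivity
  set B₁ := K + 8 * d * K / c + 4 * K / c
  have hB₁ : 0 ≤ B₁ := by positivity
  set A₂ := 10 * K * (5 * K + 4 * (d + 1) * K / c) + 32 * d * K ^ 2 / c
    + 8 * (d + 1) * K ^ 2 / c ^ 2 + 8 * (d + 1) * K ^ 2 / c + 8 * K ^ 2 / c ^ 2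
  have hA₂ : 0 ≤ A₂ := by positivity
  set B₂ := (5 * K) ^ 3 * Real.exp (5 * K)
  have hB₂ : 0 ≤ B₂ := by positivity
  set B₃ := K ^ 2 * Real.exp K + K
  have hB₃ : 0 ≤ B₃ := by positivity
  set D := A₁ + B₁ + A₂ + B₂ + B₃
  have hD : 0 ≤ D := by positivity
  refine ⟨Real.exp K * (Real.exp K * (D * (M + 1)) * T), by positivity,
    fun n hn η hη hη0 j hj => ?_⟩
  have hn0 : 0 < n := by
    rcases Nat.eq_zero_or_pos n with rfl | h
    · simp only [Nat.cast_zero, mul_zero] at hn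
      exact absurd hn (not_lt.2 (Nat.cast_nonneg d))
    · exact h
  have hn' : (0 : ℝ) < n := by exact_mod_cast hn0
  have hn1 : (1 : ℝ) ≤ n := by exact_mod_cast hn0
  have hmem : ∀ j : ℕ, (j : ℝ) ≤ T * n → (j : ℝ) / n ∈ Set.Icc 0 T := fun j hj =>
    ⟨by positivity, by rwa [div_le_iff₀ hn']⟩
  set r : ℝ := √n
  have hr1 : 1 ≤ r := Real.one_le_sqrt.2 hn1
  have hr0 : 0 < r := by linarith
  have hrn : (n : ℝ) = r ^ 2 := (Real.sq_sqrt hn'.le).symm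
  set Q : ℕ → ℝ := fun j => quadVar γ s η ((j : ℝ) / n) with hQ
  have hQb : ∀ j : ℕ, (j : ℝ) ≤ T * n → Real.exp (Q j / 2) ≤ Real.exp K ∧
      Real.exp (-(Q j / 2)) ≤ Real.exp K := fun j hj => by
    have h := abs_le.1 (hb.var_le η hη _ (hmem j hj))
    exact ⟨Real.exp_le_exp.2 (by simp only [hQ]; linarith),
      Real.exp_le_exp.2 (by simp only [hQ]; linarith)⟩
  set φ : ℕ → SimpleGraph (Fin n) → ℂ := fun j G =>
    Complex.exp (Complex.I * (statistic s η ((j : ℝ) / n) G / r : ℝ)) with hφ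
  have hφn : ∀ j G, ‖φ j G‖ = 1 := fun j G => by
    simp only [hφ]
    rw [mul_comm, Complex.norm_exp_ofReal_mul_I]
  set Ψ : ℕ → ℂ := fun j => expect (graphLaw d n j) (φ j) * (Real.exp (Q j / 2) : ℝ) with hΨ
  have hstep : ∀ j : ℕ, ((j + 1 : ℕ) : ℝ) ≤ T * n →
      ‖Ψ (j + 1) - Ψ j‖ ≤ Real.exp K * (D * (M + 1)) / r ^ 3 := by
    intro j hj1
    have hj : (j : ℝ) ≤ T * n := by push_cast at hj1; linarith
    have hxy := succ_div_sub n j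
    have hpoint : ∀ G ∈ (graphLaw d n j).support,
        ‖expect (step d G) (φ (j + 1)) - φ j G * (Real.exp (-((Q (j + 1) - Q j) / 2)) : ℝ)‖
          ≤ D / r ^ 3 * (‖deviation γ ((j : ℝ) / n) G‖ ^ 2 / n + 1) := by
      intro G hG
      have hreg := regular_of_mem_support hd hn hj hG
      have hh := hγ.one_sub_last_ge hd hT (hmem j hj)
      have h1 := hreg.abs_expect_increment_le_of_shiftDiff_eq_zero hγ hT hs hc hK hb hη hη0 hn0
        (hmem j hj).1 hxy (hmem _ hj1).2 hh
      have h2 := hreg.abs_expect_sq_sub_rate_le hγ hT hs hc hK hb hη hη0 hn0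
        (hmem j hj).1 hxy (hmem _ hj1).2 hh
      have h3 := norm_expect_cexp_sub_le (step d G) hr1 (B := 5 * K) (fun G' hG' => by
        obtain ⟨p, hp, rfl⟩ := hreg.exists_of_mem_support_step hG'
        exact hb.abs_increment_le hη hn0 (hmem j hj).1 hxy (hmem _ hj1).2 hp) h1 h2
      have hxy' : (j : ℝ) / n ≤ ((j + 1 : ℕ) : ℝ) / n := by
        have : 0 < 1 / (n : ℝ) := by positivity
        linarith
      have h4 := hb.quad_taylor η hη _ _ (hmem j hj).1 hxy' (hmem _ hj1).2
      rw [hxy] at h4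
      have h5 := abs_exp_neg_half_sub_le hn1 (hb.rate_le η hη _ (hmem j hj)) h4
      set x := (j : ℝ) / n
      set y := ((j + 1 : ℕ) : ℝ) / n
      set q := quadRate γ s η x
      set e := ‖deviation γ x G‖
      have he : 0 ≤ e := norm_nonneg _
      have hfac : expect (step d G) (φ (j + 1)) = φ j G * expect (step d G) (fun G' =>
          Complex.exp (Complex.I * (increment s η x y G G' / r : ℝ))) := by
        rw [← expect_const_mul_complex]
        refine expect_congr fun G' _ => ?_
        simp only [hφ]
        rw [← Complex.exp_add, statistic_succ η x y G G']
        congr 1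
        push_cast
        ring
      rw [hfac, ← mul_sub, norm_mul, hφn, one_mul]
      set Z := expect (step d G) (fun G' =>
          Complex.exp (Complex.I * (increment s η x y G G' / r : ℝ)))
      have h6 : ‖((1 - q / (2 * r ^ 2) : ℝ) : ℂ)
          - ((Real.exp (-((Q (j + 1) - Q j) / 2)) : ℝ) : ℂ)‖ ≤ B₃ / n ^ 2 := by
        rw [← Complex.ofReal_sub, Complex.norm_real, Real.norm_eq_abs, abs_sub_comm, ← hrn]
        exact h5
      have h7 := norm_add_le (Z - ((1 - q / (2 * r ^ 2) : ℝ) : ℂ))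
        (((1 - q / (2 * r ^ 2) : ℝ) : ℂ) - ((Real.exp (-((Q (j + 1) - Q j) / 2)) : ℝ) : ℂ))
      rw [sub_add_sub_cancel] at h7
      refine h7.trans ((add_le_add h3 h6).trans ?_)
      -- All errors are brought to the form `e²/n + 1`, whose mean is bounded by the second moment
      -- estimate.
      have her : e / r ≤ e ^ 2 / n + 1 := by
        rw [hrn, ← div_pow]
        nlinarith [sq_nonneg (e / r - 1), sq_nonneg (e / r)]
      have hE : 0 ≤ e ^ 2 / n := by positivity
      have hrr : 1 / r ≤ 1 := by
        rw [div_le_one hr0]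
        exact hr1
      have i1 : (A₁ * (e ^ 2 / n ^ 2) + B₁ / n) / r ≤ (A₁ + B₁) / r ^ 3 * (e ^ 2 / n + 1) := by
        have : (A₁ * (e ^ 2 / n ^ 2) + B₁ / n) / r = (A₁ * (e ^ 2 / n) + B₁) / r ^ 3 := by
          rw [hrn]
          field_simp
        rw [this, div_mul_eq_mul_div (A₁ + B₁)]
        have hr3 : 0 ≤ r ^ 3 := by positivity
        refine div_le_div_of_nonneg_right ?_ hr3
        nlinarith [mul_nonneg hB₁ hE]
      have i2 : A₂ * (e + 1) / n / (2 * r ^ 2) ≤ A₂ / r ^ 3 * (e ^ 2 / n + 1) := by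
        have : A₂ * (e + 1) / n / (2 * r ^ 2) = A₂ / r ^ 3 * ((e / r + 1 / r) / 2) := by
          rw [hrn]
          field_simp
        rw [this]
        refine mul_le_mul_of_nonneg_left ?_ (by positivity)
        linarith
      have i3 : B₂ / r ^ 3 ≤ B₂ / r ^ 3 * (e ^ 2 / n + 1) :=
        le_mul_of_one_le_right (by positivity) (by linarith)
      have i4 : B₃ / n ^ 2 ≤ B₃ / r ^ 3 * (e ^ 2 / n + 1) := by
        have : B₃ / (n : ℝ) ^ 2 = B₃ / r ^ 3 * (1 / r) := by
          rw [hrn]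
          field_simp
        rw [this]
        exact mul_le_mul_of_nonneg_left (by linarith) (by positivity)
      calc _ ≤ (A₁ + B₁) / r ^ 3 * (e ^ 2 / n + 1) + A₂ / r ^ 3 * (e ^ 2 / n + 1)
            + B₂ / r ^ 3 * (e ^ 2 / n + 1) + B₃ / r ^ 3 * (e ^ 2 / n + 1) := by linarith
        _ = _ := by ring
    have hdiff : Ψ (j + 1) - Ψ j = expect (graphLaw d n j) (fun G =>
        expect (step d G) (φ (j + 1)) - φ j G * (Real.exp (-((Q (j + 1) - Q j) / 2)) : ℝ))
        * (Real.exp (Q (j + 1) / 2) : ℝ) := by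
      rw [expect_sub, expect_mul_const_complex, sub_mul, mul_assoc, ← Complex.ofReal_mul,
        ← Real.exp_add]
      simp only [hΨ]
      rw [graphLaw, expect_bind]
      congr 4
      ring
    rw [hdiff, norm_mul, Complex.norm_real, Real.norm_of_nonneg (Real.exp_nonneg _)]
    have h8 := norm_expect_le_of_le hpoint
    rw [expect_const_mul, expect_add, expect_const] at h8
    have h9 : expect (graphLaw d n j) (fun G => ‖deviation γ ((j : ℝ) / n) G‖ ^ 2 / n) ≤ M := by
      rw [show (fun G : SimpleGraph (Fin n) => ‖deviation γ ((j : ℝ) / n) G‖ ^ 2 / n)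
        = fun G => (n : ℝ)⁻¹ * ‖deviation γ ((j : ℝ) / n) G‖ ^ 2 from
          funext fun G => div_eq_inv_mul _ _]
      rw [expect_const_mul, inv_mul_le_iff₀ hn', mul_comm (n : ℝ) M]
      exact hM n hn j hj
    calc _ ≤ (D / r ^ 3 * (M + 1)) * Real.exp K :=
          mul_le_mul (h8.trans (mul_le_mul_of_nonneg_left (by linarith) (by positivity)))
            (hQb _ hj1).1 (Real.exp_nonneg _) (by positivity)
      _ = _ := by ring
  have h0 : Ψ 0 = 1 := by
    have h00 : (Nat.cast 0 : ℝ) / n = 0 := by simp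
    simp only [hΨ, hQ, hφ, graphLaw]
    rw [expect_pure, h00, hγ.quadVar_zero hs, statistic, hs.transport_zero]
    simp [total, degClass, show ((⟨0, by omega⟩ : Fin (d + 1))) = 0 from rfl]
  have hsum : ∀ j : ℕ, (j : ℝ) ≤ T * n →
      ‖Ψ j - 1‖ ≤ j * (Real.exp K * (D * (M + 1)) / r ^ 3) := by
    intro j
    induction j with
    | zero => simp [h0]
    | succ j ih =>
      intro hj1
      have ih' := ih (by push_cast at hj1; linarith)
      have h := norm_add_le (Ψ (j + 1) - Ψ j) (Ψ j - 1)
      rw [sub_add_sub_cancel] at h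
      push_cast
      linarith [hstep j hj1]
  have hfin : expect (graphLaw d n j) (φ j) - (Real.exp (-(Q j / 2)) : ℝ)
      = (Ψ j - 1) * (Real.exp (-(Q j / 2)) : ℝ) := by
    simp only [hΨ]
    rw [sub_mul, one_mul, mul_assoc, ← Complex.ofReal_mul, ← Real.exp_add, add_neg_cancel,
      Real.exp_zero, Complex.ofReal_one, mul_one]
  change ‖expect (graphLaw d n j) (φ j) - (Real.exp (-(Q j / 2)) : ℝ)‖ ≤ _
  rw [hfin, norm_mul, Complex.norm_real, Real.norm_of_nonneg (Real.exp_nonneg _)]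
  calc _ ≤ (j * (Real.exp K * (D * (M + 1)) / r ^ 3)) * Real.exp K :=
        mul_le_mul (hsum j hj) (hQb j hj).2 (Real.exp_nonneg _) (by positivity)
    _ ≤ (T * n * (Real.exp K * (D * (M + 1)) / r ^ 3)) * Real.exp K := by gcongr
    _ = _ := by
      rw [hrn]
      field_simp

end Moments

/-! ### The limiting covariance matrix -/

section Covariance

variable {d : ℕ} {γ : ℝ → EuclideanSpace ℝ (Fin (d + 1))} {T : ℝ} {s : ℝ → ℝ} {n : ℕ}

/-- The degree as a test vector. -/
def degreeVec (d : ℕ) : Fin (d + 1) → ℝ := fun k => (k : ℝ)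

/-- The test vector `θ` corrected by the multiple of the degree which makes it stationary for the
drift at `z`. -/
def corrected (z : EuclideanSpace ℝ (Fin (d + 1))) (θ : Fin (d + 1) → ℝ) : Fin (d + 1) → ℝ :=
  θ - ((shiftDiff d θ ⬝ᵥ z.ofLp) / (1 - z (Fin.last d))) • degreeVec d

/-- The covariance matrix of the corrected coordinates under the probability vector `z`. -/
def covMatrix (z : EuclideanSpace ℝ (Fin (d + 1))) : Matrix (Fin (d + 1)) (Fin (d + 1)) ℝ :=
  Matrix.of fun i j =>
    (fun k => corrected z (Pi.single i 1) k * corrected z (Pi.single j 1) k) ⬝ᵥ z.ofLp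
      - (corrected z (Pi.single i 1) ⬝ᵥ z.ofLp) * (corrected z (Pi.single j 1) ⬝ᵥ z.ofLp)

lemma corrected_sum (z : EuclideanSpace ℝ (Fin (d + 1))) (θ : Fin (d + 1) → ℝ) :
    corrected z θ = ∑ i, θ i • corrected z (Pi.single i 1) := by
  let L : (Fin (d + 1) → ℝ) →ₗ[ℝ] (Fin (d + 1) → ℝ) :=
    { toFun := corrected z
      map_add' := fun a b => by
        simp only [corrected, map_add, add_dotProduct, add_div, add_smul]
        abel
      map_smul' := fun c a => by
        simp only [corrected, map_smul, smul_dotProduct, smul_eq_mul, mul_div_assoc, mul_smul,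
          smul_sub, RingHom.id_apply] }
  have h := L.pi_apply_eq_sum_univ θ
  refine h.trans (Finset.sum_congr rfl fun i _ => ?_)
  refine congrArg (fun v => θ i • corrected z v) (funext fun k => ?_)
  rw [Pi.single_apply]
  simp only [eq_comm]

lemma dotProduct_covMatrix_mulVec (z : EuclideanSpace ℝ (Fin (d + 1))) (θ : Fin (d + 1) → ℝ) :
    θ ⬝ᵥ (covMatrix z).mulVec θ
      = (fun k => corrected z θ k ^ 2) ⬝ᵥ z.ofLp - (corrected z θ ⬝ᵥ z.ofLp) ^ 2 := by
  set β : Fin (d + 1) → Fin (d + 1) → ℝ := fun i => corrected z (Pi.single i 1)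
  have h1 : ∀ k, corrected z θ k = ∑ i, θ i * β i k := fun k => by
    rw [corrected_sum]
    simp [Finset.sum_apply, β]
  have h2 : corrected z θ ⬝ᵥ z.ofLp = ∑ i, θ i * (β i ⬝ᵥ z.ofLp) := by
    rw [corrected_sum, sum_dotProduct]
    simp [β, smul_dotProduct]
  have h3 : (fun k => corrected z θ k ^ 2) ⬝ᵥ z.ofLp
      = ∑ i, ∑ j, θ i * ((fun k => β i k * β j k) ⬝ᵥ z.ofLp) * θ j := by
    simp only [dotProduct, h1, sq, Finset.sum_mul, Finset.mul_sum]
    rw [Finset.sum_comm]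
    refine Finset.sum_congr rfl fun i _ => ?_
    rw [Finset.sum_comm]
    refine Finset.sum_congr rfl fun j _ => Finset.sum_congr rfl fun k _ => by ring
  rw [h2, h3, sq, Finset.sum_mul_sum, ← Finset.sum_sub_distrib]
  change ∑ i, θ i * ∑ j, covMatrix z i j * θ j = _
  refine Finset.sum_congr rfl fun i _ => ?_
  rw [← Finset.sum_sub_distrib, Finset.mul_sum]
  refine Finset.sum_congr rfl fun j _ => ?_
  change θ i * (((fun k => β i k * β j k) ⬝ᵥ z.ofLp - (β i ⬝ᵥ z.ofLp) * (β j ⬝ᵥ z.ofLp)) * θ j) = _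
  ring

/-- The quadratic form at `θ` is the variance of `corrected (γ t) θ` under the probability vector `γ
t`. -/
lemma posSemidef_covMatrix (hγ : IsSolution d γ) {t : ℝ} (ht : t ∈ Set.Ico (0 : ℝ) (d / 2)) :
    (covMatrix (γ t)).PosSemidef := by
  refine Matrix.PosSemidef.of_dotProduct_mulVec_nonneg ?_ fun θ => ?_
  · ext i j
    simp only [covMatrix, Matrix.conjTranspose_apply, Matrix.of_apply, star_trivial]
    rw [mul_comm (corrected (γ t) (Pi.single i 1) ⬝ᵥ _)]
    simp only [mul_comm (corrected (γ t) (Pi.single i 1) _)]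
  · rw [star_trivial, dotProduct_covMatrix_mulVec]
    set b := corrected (γ t) θ
    set μ := b ⬝ᵥ (γ t).ofLp
    have h : (fun k => b k ^ 2) ⬝ᵥ (γ t).ofLp - μ ^ 2 = ∑ k, (b k - μ) ^ 2 * γ t k := by
      have h1 : ∀ k, (b k - μ) ^ 2 * γ t k
          = b k ^ 2 * γ t k - 2 * μ * (b k * γ t k) + μ ^ 2 * γ t k := fun k => by ring
      simp only [h1, Finset.sum_add_distrib, Finset.sum_sub_distrib, ← Finset.mul_sum,
        hγ.sum_eq_one ht]
      rw [show ∑ k, b k * γ t k = μ from rfl]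
      simp only [dotProduct]
      ring
    rw [h]
    exact Finset.sum_nonneg fun k _ => mul_nonneg (sq_nonneg _) (hγ.nonneg ht k)

lemma continuousOn_covMatrix (hγ : IsSolution d γ) :
    ContinuousOn (fun t => covMatrix (γ t)) (Set.Ico (0 : ℝ) (d / 2)) := by
  have hc : ∀ k, ContinuousOn (fun t => γ t k) (Set.Ico (0 : ℝ) (d / 2)) := fun k t ht =>
    (hγ.deriv t ht k).continuousWithinAt
  have hdot : ∀ a : ℝ → Fin (d + 1) → ℝ, (∀ k, ContinuousOn (fun t => a t k)
      (Set.Ico (0 : ℝ) (d / 2))) →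
      ContinuousOn (fun t => a t ⬝ᵥ (γ t).ofLp) (Set.Ico (0 : ℝ) (d / 2)) := fun a ha =>
    continuousOn_finsetSum _ fun k _ => (ha k).mul (hc k)
  have hb : ∀ i k, ContinuousOn (fun t => corrected (γ t) (Pi.single i 1) k)
      (Set.Ico (0 : ℝ) (d / 2)) := fun i k => by
    simp only [corrected, Pi.sub_apply, Pi.smul_apply, smul_eq_mul]
    refine continuousOn_const.sub (ContinuousOn.mul (ContinuousOn.div ?_ ?_ ?_) continuousOn_const)
    · exact hdot _ fun k => continuousOn_const
    · exact continuousOn_const.sub (hc _)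
    · intro t ht
      linarith [hγ.lt_one t ht]
  refine continuousOn_pi.2 fun i => continuousOn_pi.2 fun j => ?_
  exact (hdot _ fun k => (hb i k).mul (hb j k)).sub ((hdot _ (hb i)).mul (hdot _ (hb j)))

/-- For the degree vector, `D` paired with `γ` gives `∑ γ_k - γ_d = 1 - γ_d`, the denominator in
`corrected`. -/
lemma shiftDiff_corrected_dotProduct (hγ : IsSolution d γ) {t : ℝ}
    (ht : t ∈ Set.Ico (0 : ℝ) (d / 2)) (θ : Fin (d + 1) → ℝ) :
    shiftDiff d (corrected (γ t) θ) ⬝ᵥ (γ t).ofLp = 0 := by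
  have h := hγ.lt_one t ht
  have h1 : (1 : ℝ) - γ t (Fin.last d) ≠ 0 := by linarith
  rw [corrected, map_sub, map_smul, sub_dotProduct, smul_dotProduct,
    show shiftDiff d (degreeVec d) ⬝ᵥ (γ t).ofLp = _ from shiftDiff_val_dotProduct _, hγ.sum_eq_one ht, smul_eq_mul, div_mul_cancel₀ _ h1, sub_self]

lemma exists_norm_corrected_le (hγ : IsSolution d γ) (hd : 0 < d) (hT : T < d / 2)
    (θ : Fin (d + 1) → ℝ) : ∃ R, 0 ≤ R ∧ ∀ t ∈ Set.Icc 0 T, ‖corrected (γ t) θ‖ ≤ R := by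
  have hc := one_sub_pos hd hT
  refine ⟨‖θ‖ + 2 * ‖θ‖ / (1 - 2 * T / d) * ‖degreeVec d‖, by positivity, fun t ht => ?_⟩
  refine (norm_sub_le _ _).trans (add_le_add_right ?_ _)
  rw [norm_smul]
  refine mul_le_mul_of_nonneg_right ?_ (norm_nonneg _)
  have h1 := hγ.one_sub_last_ge hd hT ht
  rw [Real.norm_eq_abs, abs_div, abs_of_pos (hc.trans_le h1)]
  refine div_le_div₀ (by positivity) ?_ hc h1
  exact hγ.abs_dotProduct_le hT ht _ fun k =>
    (norm_le_pi_norm (shiftDiff d θ) k).trans (norm_shiftDiff_le θ)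

end Covariance

/-! ### Convergence of the characteristic functions -/

section CharFun

open scoped Classical

variable {d : ℕ} {γ : ℝ → EuclideanSpace ℝ (Fin (d + 1))} {T : ℝ} {s : ℝ → ℝ} {n : ℕ}

lemma integral_toMeasure_map {α E F : Type*} [Fintype α] [TopologicalSpace E]
    [MeasurableSpace E] [OpensMeasurableSpace E] [NormedAddCommGroup F] [NormedSpace ℝ F]
    [CompleteSpace F] [SecondCountableTopology F] (p : PMF α) (g : α → E) {f : E → F}
    (hf : Continuous f) :
    ∫ x, f x ∂(p.map g).toMeasure = expect p fun a => f (g a) := by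
  let _ : MeasurableSpace α := ⊤
  borelize F
  rw [← PMF.toMeasure_map g p measurable_from_top,
    integral_map measurable_from_top.aemeasurable hf.measurable.aestronglyMeasurable,
    PMF.integral_eq_sum, expect]

instance isProbabilityMeasure_normalizedLaw (n m : ℕ) :
    IsProbabilityMeasure (normalizedLaw d γ n m) :=
  PMF.toMeasure.isProbabilityMeasure _

lemma charFun_normalizedLaw (n m : ℕ) (θ : EuclideanSpace ℝ (Fin (d + 1))) :
    charFun (normalizedLaw d γ n m) θ = expect (graphLaw d n m) fun G =>
      Complex.exp (Complex.I * ((θ.ofLp ⬝ᵥ deviation γ ((m : ℝ) / n) G) / √n : ℝ)) := by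
  rw [charFun_apply, normalizedLaw, integral_toMeasure_map _ _ (by fun_prop)]
  refine expect_congr fun G _ => ?_
  rw [mul_comm Complex.I]
  congr 3
  rw [inner_smul_left, EuclideanSpace.inner_eq_star_dotProduct, star_trivial, deviation]
  simp
  ring

/-- The degree sum `2m` is deterministic and agrees with `n` times the mean degree `2m/n` of
`γ(m/n)`. Hence correcting `θ` does not alter its pairing with the deviation. -/
lemma degreeVec_dotProduct_deviation (hγ : IsSolution d γ) {G : SimpleGraph (Fin n)} {m : ℕ}
    (hn : 0 < n) (hG : ∀ v, G.degree v ≤ d) (hm : ∑ v, G.degree v = 2 * m)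
    (ht : (m : ℝ) / n ∈ Set.Ico (0 : ℝ) (d / 2)) :
    degreeVec d ⬝ᵥ deviation γ ((m : ℝ) / n) G = 0 := by
  have hn' : (0 : ℝ) < n := by exact_mod_cast hn
  have h := total_eq_dotProduct_deviation (γ := γ) hG ((m : ℝ) / n) (degreeVec d)
  have h1 : total d G (degreeVec d) = 2 * m := by
    have h2 : ∀ v, degreeVec d (degClass d G v) = (G.degree v : ℝ) := fun v => by
      simp [degreeVec, degClass, hG v]
    simp only [total, h2]
    exact_mod_cast hm
  have h3 : degreeVec d ⬝ᵥ (γ ((m : ℝ) / n)).ofLp = 2 * (m / n) := hγ.sum_val_mul ht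
  rw [h1, h3] at h
  have h4 : (n : ℝ) * (2 * (m / n)) = 2 * m := by field_simp
  linarith

lemma exists_charFun_sub_le (hγ : IsSolution d γ) (hd : 0 < d) (hT0 : 0 ≤ T) (hT : T < d / 2)
    (θ : EuclideanSpace ℝ (Fin (d + 1))) : ∃ C, ∀ n : ℕ, (d : ℝ) < (1 - 2 * T / d) * n →
      ∀ m : ℕ, (m : ℝ) ≤ T * n →
      ‖charFun (normalizedLaw d γ n m) θ
        - charFun (multivariateGaussian 0 (covMatrix (γ ((m : ℝ) / n)))) θ‖ ≤ C / √n := by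
  obtain ⟨s, hs⟩ := hγ.exists_isClock hT0 hT
  obtain ⟨P, hP0, hP⟩ := hs.exists_norm_flow_le
  obtain ⟨R, hR0, hR⟩ := exists_norm_corrected_le hγ hd hT θ.ofLp
  obtain ⟨C, -, hC⟩ := exists_charFun_bound hγ hd hT0 hT hs (R := P * R) (by positivity)
  refine ⟨C, fun n hn m hm => ?_⟩
  have hn0 : 0 < n := by
    rcases Nat.eq_zero_or_pos n with rfl | h
    · simp only [Nat.cast_zero, mul_zero] at hn
      exact absurd hn (not_lt.2 (Nat.cast_nonneg d))
    · exact h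
  have hn' : (0 : ℝ) < n := by exact_mod_cast hn0
  have ht : (m : ℝ) / n ∈ Set.Icc 0 T := ⟨by positivity, by rwa [div_le_iff₀ hn']⟩
  have ht' := IsSolution.mem_Ico hT ht
  set t := (m : ℝ) / n with ht_def
  set b := corrected (γ t) θ.ofLp with hb
  -- Pulled back to time `0`, so that the transport reaches `b` exactly at time `t`. It varies with
  -- `m/n`, but stays in the ball of radius `P * R`.
  set η := flow d (s t) b
  have htr : transport s η t = b := transport_flow b t
  have hη : ‖η‖ ≤ P * R := ((flow d (s t)).le_opNorm b).trans
    (mul_le_mul (hP t ht).1 (hR t ht) (norm_nonneg _) hP0)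
  have hη0 : shiftDiff d η 0 = 0 := by
    rw [← hγ.transport_dotProduct hT hs (shiftDiff d η) ht, shiftDiff_transport, htr]
    exact shiftDiff_corrected_dotProduct hγ ht' θ.ofLp
  have hquad : quadVar γ s η t = θ.ofLp ⬝ᵥ (covMatrix (γ t)).mulVec θ.ofLp := by
    rw [dotProduct_covMatrix_mulVec, quadVar, ← hγ.transport_dotProduct hT hs η ht, htr]
  have h := hC n hn η hη hη0 m hm
  rw [← ht_def, hquad] at h
  rw [charFun_normalizedLaw, charFun_multivariateGaussian (posSemidef_covMatrix hγ ht')]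
  convert! h using 3
  · refine expect_congr fun G hG => ?_
    obtain ⟨h1, h2⟩ := degree_le_of_mem_support hd hn hm hG
    rw [statistic_eq hγ hT hs h1 ht, htr, hb, corrected, sub_dotProduct, smul_dotProduct,
      degreeVec_dotProduct_deviation hγ hn0 h1 h2 ht', smul_zero, sub_zero]
  · rw [inner_zero_right, Complex.ofReal_exp]
    congr 1
    push_cast
    ring

/-! ### Weak convergence -/

/-- If `d - 2 t₀ < δ`, then `γ_d > 1 - δ` on all of `[t₀, d/2)`, so `⌈t₀ n⌉` lies in the set
defining `m_δ` for large `n`; in particular the infimum is not the default value for the empty set.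
Taking `T` halfway from `t₀` to `d/2` absorbs the rounding. -/
lemma exists_mDelta_le (hγ : IsSolution d γ) (hd : 0 < d) {δ : ℝ} (hδ : 0 < δ) :
    ∃ T : ℝ, 0 ≤ T ∧ T < d / 2 ∧ ∀ᶠ n : ℕ in atTop, (mDelta d γ δ n : ℝ) ≤ T * n := by
  have hd' : (0 : ℝ) < d := by exact_mod_cast hd
  obtain ⟨t₀, h0, h1, h2⟩ : ∃ t₀ : ℝ, 0 ≤ t₀ ∧ t₀ < d / 2 ∧ d - 2 * t₀ < δ := by
    rcases le_total (0 : ℝ) (d / 2 - δ / 4) with h | h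
    · exact ⟨d / 2 - δ / 4, h, by linarith, by linarith⟩
    · exact ⟨0, le_rfl, by linarith, by linarith⟩
  refine ⟨(t₀ + d / 2) / 2, by linarith, by linarith, ?_⟩
  have hgap : 0 < (d / 2 - t₀) / 2 := by linarith
  filter_upwards [eventually_ge_atTop (⌈1 / ((d / 2 - t₀) / 2)⌉₊ + 1)] with n hn
  have hn0 : 0 < n := by omega
  have hn' : (0 : ℝ) < n := by exact_mod_cast hn0
  have hn1 : 1 ≤ (d / 2 - t₀) / 2 * n := by
    have h3 : 1 / ((d / 2 - t₀) / 2) ≤ n := (Nat.le_ceil _).trans (by exact_mod_cast (by omega))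
    rwa [div_le_iff₀' hgap] at h3
  set m := ⌈t₀ * n⌉₊
  have hm1 : t₀ * n ≤ m := Nat.le_ceil _
  have hm2 : (m : ℝ) < t₀ * n + 1 := Nat.ceil_lt_add_one (by positivity)
  have hmT : (m : ℝ) ≤ (t₀ + d / 2) / 2 * n := by linarith
  have hle : mDelta d γ δ n ≤ m := by
    refine Nat.sInf_le ?_
    have ht : (m : ℝ) / n ∈ Set.Ico (0 : ℝ) (d / 2) := by
      refine ⟨by positivity, lt_of_le_of_lt ((div_le_iff₀ hn').2 hmT) (by linarith)⟩
    have h3 := hγ.le_last ht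
    have h4 : t₀ ≤ (m : ℝ) / n := by rwa [le_div_iff₀ hn']
    change 1 - δ < γ ((m : ℝ) / n) (Fin.last d)
    linarith
  exact (Nat.cast_le.2 hle).trans hmT

lemma tendsto_charFun_covMatrix (hγ : IsSolution d γ) {x : ℕ → ℝ} {t : ℝ}
    (hx : ∀ k, x k ∈ Set.Ico (0 : ℝ) (d / 2)) (ht : t ∈ Set.Ico (0 : ℝ) (d / 2))
    (hxt : Tendsto x atTop (𝓝 t)) (θ : EuclideanSpace ℝ (Fin (d + 1))) :
    Tendsto (fun k => charFun (multivariateGaussian 0 (covMatrix (γ (x k)))) θ) atTop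
      (𝓝 (charFun (multivariateGaussian 0 (covMatrix (γ t))) θ)) := by
  simp only [charFun_multivariateGaussian (posSemidef_covMatrix hγ (hx _)),
    charFun_multivariateGaussian (posSemidef_covMatrix hγ ht)]
  have hS : Tendsto (fun k => covMatrix (γ (x k))) atTop (𝓝 (covMatrix (γ t))) :=
    (continuousOn_covMatrix hγ t ht).tendsto.comp
      (tendsto_nhdsWithin_iff.2 ⟨hxt, Eventually.of_forall hx⟩)
  have hq : Continuous fun M : Matrix (Fin (d + 1)) (Fin (d + 1)) ℝ =>
      Complex.exp (((inner ℝ θ (0 : EuclideanSpace ℝ (Fin (d + 1))) : ℝ) : ℂ) * Complex.I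
        - ((θ.ofLp ⬝ᵥ M.mulVec θ.ofLp : ℝ) : ℂ) / 2) := by
    have : Continuous fun M : Matrix (Fin (d + 1)) (Fin (d + 1)) ℝ =>
        θ.ofLp ⬝ᵥ M.mulVec θ.ofLp :=
      continuous_const.dotProduct (continuous_id.matrix_mulVec continuous_const)
    fun_prop
  exact (hq.tendsto _).comp hS

/-- If uniformity failed, bad pairs `(n, m)` would exist along a subsequence with `m/n` convergent
in `[0, T]`. There both the process laws and the Gaussians converge to the Gaussian at the limit
time, so the integrals of `f` could not stay `ε` apart. -/
lemma eventually_abs_integral_sub_lt (hγ : IsSolution d γ) (hd : 0 < d) (hT0 : 0 ≤ T)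
    (hT : T < d / 2) (f : EuclideanSpace ℝ (Fin (d + 1)) →ᵇ ℝ) {ε : ℝ} (hε : 0 < ε) :
    ∀ᶠ n : ℕ in atTop, ∀ m : ℕ, (m : ℝ) ≤ T * n →
      |(∫ x, f x ∂(normalizedLaw d γ n m)) -
        ∫ x, f x ∂(multivariateGaussian 0 (covMatrix (γ ((m : ℝ) / n))))| < ε := by
  by_contra hcon
  rw [not_eventually] at hcon
  have hc := one_sub_pos hd hT
  have hlarge : ∀ᶠ n : ℕ in atTop, (d : ℝ) < (1 - 2 * T / d) * n :=
    (tendsto_natCast_atTop_atTop.const_mul_atTop hc).eventually_gt_atTop _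
  obtain ⟨φ, hφ, hφP⟩ := extraction_of_frequently_atTop (hcon.and_eventually hlarge)
  simp only [not_forall, not_lt] at hφP
  choose hφ1 hφ2 using hφP
  choose m hm hmε using hφ1
  have hφ0 : ∀ k, (0 : ℝ) < φ k := fun k => by
    have h := hφ2 k
    rcases Nat.eq_zero_or_pos (φ k) with h0 | h0
    · rw [h0, Nat.cast_zero, mul_zero] at h
      exact absurd h (not_lt.2 (Nat.cast_nonneg d))
    · exact_mod_cast h0
  have hx : ∀ k, (m k : ℝ) / φ k ∈ Set.Icc 0 T := fun k =>
    ⟨by positivity, (div_le_iff₀ (hφ0 k)).2 (hm k)⟩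
  obtain ⟨t, ht, ψ, hψ, hψt⟩ := isCompact_Icc.tendsto_subseq hx
  have ht' := IsSolution.mem_Ico hT ht
  have hgauss := fun θ => tendsto_charFun_covMatrix hγ
    (fun k => IsSolution.mem_Ico hT (hx (ψ k))) ht' hψt θ
  have hlaw : ∀ θ, Tendsto (fun k => charFun (normalizedLaw d γ (φ (ψ k)) (m (ψ k))) θ) atTop
      (𝓝 (charFun (multivariateGaussian 0 (covMatrix (γ t))) θ)) := by
    intro θ
    obtain ⟨C, hC⟩ := exists_charFun_sub_le hγ hd hT0 hT θ
    have hsqrt : Tendsto (fun k => C / √(φ (ψ k) : ℝ)) atTop (𝓝 0) :=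
      tendsto_const_nhds.div_atTop (Real.tendsto_sqrt_atTop.comp
        (tendsto_natCast_atTop_atTop.comp (hφ.comp hψ).tendsto_atTop))
    have hdiff := squeeze_zero_norm (fun k => hC _ (hφ2 (ψ k)) _ (hm (ψ k))) hsqrt
    simpa using hdiff.add (hgauss θ)
  have h1 := (ProbabilityMeasure.tendsto_iff_forall_integral_tendsto.1
    (ProbabilityMeasure.tendsto_of_tendsto_charFun
      (μ := fun k => ⟨normalizedLaw d γ (φ (ψ k)) (m (ψ k)), inferInstance⟩)
      (μ₀ := ⟨multivariateGaussian 0 (covMatrix (γ t)), inferInstance⟩) hlaw)) f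
  have h2 := (ProbabilityMeasure.tendsto_iff_forall_integral_tendsto.1
    (ProbabilityMeasure.tendsto_of_tendsto_charFun
      (μ := fun k => ⟨multivariateGaussian 0 (covMatrix (γ ((m (ψ k) : ℝ) / φ (ψ k)))),
        inferInstance⟩)
      (μ₀ := ⟨multivariateGaussian 0 (covMatrix (γ t)), inferInstance⟩) hgauss)) f
  have h3 := (h1.sub h2).abs
  rw [sub_self, abs_zero] at h3
  obtain ⟨k, hk⟩ := (h3.eventually_lt_const hε).exists
  exact absurd hk (not_lt.2 (hmε (ψ k)))

end CharFun

/-! ### Existence of the solution -/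

section Existence

/-- The Poisson weight `e⁻ˢ sᵏ / k!`. -/
def poissonWeight (k : ℕ) (s : ℝ) : ℝ := Real.exp (-s) * s ^ k / k.factorial

/-- The cumulated Poisson weight `∑_{j < k} e⁻ˢ sʲ / j!`. -/
def poissonCum (k : ℕ) (s : ℝ) : ℝ := ∑ j ∈ Finset.range k, poissonWeight j s

lemma poissonWeight_nonneg (k : ℕ) {s : ℝ} (hs : 0 ≤ s) : 0 ≤ poissonWeight k s := by
  unfold poissonWeight
  positivity

lemma poissonCum_pos {k : ℕ} (hk : 0 < k) {s : ℝ} (hs : 0 ≤ s) : 0 < poissonCum k s := by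
  refine Finset.sum_pos' (fun j _ => poissonWeight_nonneg j hs) ⟨0, by simpa using hk, ?_⟩
  simp [poissonWeight, Real.exp_pos]

lemma hasDerivAt_poissonWeight_zero (s : ℝ) :
    HasDerivAt (poissonWeight 0) (-poissonWeight 0 s) s := by
  have h : poissonWeight 0 = fun s => Real.exp (-s) := by
    ext s
    simp [poissonWeight]
  rw [h]
  simpa using (hasDerivAt_neg s).exp

lemma hasDerivAt_poissonWeight_succ (k : ℕ) (s : ℝ) :
    HasDerivAt (poissonWeight (k + 1)) (poissonWeight k s - poissonWeight (k + 1) s) s := by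
  have he : HasDerivAt (fun s : ℝ => Real.exp (-s)) (-Real.exp (-s)) s := by
    simpa using (hasDerivAt_neg s).exp
  refine ((he.fun_mul (hasDerivAt_pow (k + 1) s)).div_const
    ((k + 1).factorial : ℝ)).congr_deriv ?_
  simp only [poissonWeight, Nat.factorial_succ, Nat.add_sub_cancel]
  have : (k.factorial : ℝ) ≠ 0 := by exact_mod_cast k.factorial_ne_zero
  have : (k + 1 : ℝ) ≠ 0 := by positivity
  push_cast
  field_simp
  ring

lemma hasDerivAt_poissonCum_succ (k : ℕ) (s : ℝ) :
    HasDerivAt (poissonCum (k + 1)) (-poissonWeight k s) s := by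
  induction k with
  | zero =>
    have : poissonCum (0 + 1) = poissonWeight 0 := by
      ext s
      simp [poissonCum]
    rw [this]
    exact hasDerivAt_poissonWeight_zero s
  | succ k ih =>
    have : poissonCum (k + 1 + 1) = poissonCum (k + 1) + poissonWeight (k + 1) := by
      ext s
      simp [poissonCum, Finset.sum_range_succ]
    rw [this]
    refine (ih.add (hasDerivAt_poissonWeight_succ k s)).congr_deriv ?_
    ring

lemma poissonWeight_zero_right (k : ℕ) : poissonWeight k 0 = if k = 0 then 1 else 0 := by
  rcases k with _ | k <;> simp [poissonWeight]

lemma poissonCum_succ_zero_right (k : ℕ) : poissonCum (k + 1) 0 = 1 := by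
  simp [poissonCum, poissonWeight_zero_right]

lemma tendsto_poissonCum (k : ℕ) : Tendsto (poissonCum k) atTop (𝓝 0) := by
  have : Tendsto (fun s => ∑ j ∈ Finset.range k, poissonWeight j s) atTop
      (𝓝 (∑ _j ∈ Finset.range k, (0 : ℝ))) := by
    refine tendsto_finsetSum _ fun j _ => ?_
    have h := (Real.tendsto_pow_mul_exp_neg_atTop_nhds_zero j).div_const (j.factorial : ℝ)
    rw [zero_div] at h
    refine h.congr fun s => ?_
    rw [poissonWeight, mul_comm]
  rw [Finset.sum_const_zero] at this
  exact this

/-- The time as a function of the clock. -/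
def clockTime (d : ℕ) (s : ℝ) : ℝ := (d - ∑ m ∈ Finset.range d, poissonCum (m + 1) s) / 2

/-- `clockTime` is half the mean of `min(N, d)` for `N` Poisson of mean `s`, and its rate is half
the probability of `N < d`. This is the inverse of `s' = 2 / (1 - γ_d)`. -/
lemma hasDerivAt_clockTime (d : ℕ) (s : ℝ) : HasDerivAt (clockTime d) (poissonCum d s / 2) s := by
  have h := ((HasDerivAt.fun_sum fun m (_ : m ∈ Finset.range d) =>
    hasDerivAt_poissonCum_succ m s).const_sub (d : ℝ)).div_const 2
  refine h.congr_deriv ?_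
  rw [Finset.sum_neg_distrib, neg_neg, poissonCum]

lemma clockTime_zero (d : ℕ) : clockTime d 0 = 0 := by
  simp [clockTime, poissonCum_succ_zero_right]

lemma tendsto_clockTime (d : ℕ) : Tendsto (clockTime d) atTop (𝓝 (d / 2)) := by
  have h := ((tendsto_finsetSum (Finset.range d) fun m _ =>
    tendsto_poissonCum (m + 1)).const_sub (d : ℝ)).div_const 2
  rw [Finset.sum_const_zero, sub_zero] at h
  exact h

lemma continuous_poissonCum (k : ℕ) : Continuous (poissonCum k) := by
  unfold poissonCum poissonWeight
  fun_prop

/-- `clockTime` has a differentiable inverse on `[0, d / 2)`. -/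
lemma exists_clock_inverse {d : ℕ} (hd : 0 < d) : ∃ S : ℝ → ℝ, S 0 = 0 ∧
    ∀ t ∈ Set.Ico (0 : ℝ) (d / 2), 0 ≤ S t ∧ HasDerivAt S (2 / poissonCum d (S t)) t := by
  -- Replacing `r` by `max r 0` keeps the integrand positive on the whole line. Thus `F` is strictly
  -- monotone everywhere and its inverse is differentiable on both sides of `t = 0`.
  set g : ℝ → ℝ := fun r => poissonCum d (max r 0) / 2
  have hg : Continuous g := by
    have := continuous_poissonCum d
    fun_prop
  have hgpos : ∀ r, 0 < g r := fun r => half_pos (poissonCum_pos hd (le_max_right r 0))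
  set F : ℝ → ℝ := fun s => ∫ r in (0 : ℝ)..s, g r
  have hF : ∀ s, HasStrictDerivAt F (g s) s := fun s => hg.integral_hasStrictDerivAt 0 s
  have hmono : StrictMono F := strictMono_of_deriv_pos fun s => by
    rw [(hF s).hasDerivAt.deriv]
    exact hgpos s
  have hFeq : ∀ s, 0 ≤ s → F s = clockTime d s := fun s hs => by
    rw [← sub_zero (clockTime d s), ← clockTime_zero d,
      ← intervalIntegral.integral_eq_sub_of_hasDerivAt (fun r _ => hasDerivAt_clockTime d r)
        ((continuous_poissonCum d).div_const 2 |>.intervalIntegrable _ _)]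
    refine intervalIntegral.integral_congr fun r hr => ?_
    rw [Set.uIcc_of_le hs] at hr
    simp only [g, max_eq_left hr.1]
  have hinv : ∀ s, Function.invFun F (F s) = s := Function.leftInverse_invFun hmono.injective
  have hF0 : F 0 = 0 := intervalIntegral.integral_same
  refine ⟨Function.invFun F, ?_, fun t ht => ?_⟩
  · conv_lhs => rw [← hF0]
    exact hinv 0
  · obtain ⟨b, hb1, hb2⟩ := ((tendsto_clockTime d).eventually_const_lt ht.2 |>.and
      (eventually_ge_atTop 0)).exists
    have hcont : ContinuousOn (clockTime d) (Set.Icc 0 b) := fun s _ =>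
      (hasDerivAt_clockTime d s).continuousAt.continuousWithinAt
    obtain ⟨s, hs, rfl⟩ := intermediate_value_Icc hb2 hcont
      (show t ∈ Set.Icc (clockTime d 0) (clockTime d b) from ⟨by rw [clockTime_zero]; exact ht.1, hb1.le⟩)
    rw [← hFeq s hs.1, hinv]
    refine ⟨hs.1, ?_⟩
    have h := ((hF s).to_local_left_inverse (hgpos s).ne' (Eventually.of_forall hinv)).hasDerivAt
    refine h.congr_deriv ?_
    simp only [g, max_eq_left hs.1, inv_div]

/-- The law of `min(N, d)`, with `N` Poisson of mean `S t`: the Poisson weights flow from `k` to `k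
+ 1` at unit rate in the clock, class `d` collects the tail, and the chain rule supplies `2 / (1 -
γ_d)`. -/
lemma exists_isSolution {d : ℕ} (hd : 0 < d) :
    ∃ γ : ℝ → EuclideanSpace ℝ (Fin (d + 1)), IsSolution d γ := by
  obtain ⟨S, hS0, hS⟩ := exists_clock_inverse hd
  obtain ⟨e, rfl⟩ : ∃ e, d = e + 1 := ⟨d - 1, by omega⟩
  set γ : ℝ → EuclideanSpace ℝ (Fin (e + 1 + 1)) := fun t => WithLp.toLp 2
    (Fin.snoc (α := fun _ => ℝ) (fun j : Fin (e + 1) => poissonWeight j (S t))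
      (1 - poissonCum (e + 1) (S t)))
  have hlast : ∀ t, γ t (Fin.last (e + 1)) = 1 - poissonCum (e + 1) (S t) := fun t => by
    simp [γ]
  have hcast : ∀ t (j : Fin (e + 1)), γ t j.castSucc = poissonWeight j (S t) := fun t j => by
    simp [γ]
  refine ⟨γ, ⟨fun k => ?_, fun t ht => ?_, fun t ht k => ?_⟩⟩
  · refine Fin.lastCases ?_ (fun j => ?_) k
    · rw [hlast, hS0, poissonCum_succ_zero_right, if_neg (Fin.last_pos).ne', sub_self]
    · have h : j.castSucc = 0 ↔ (j : ℕ) = 0 := by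
        rw [Fin.ext_iff]
        rfl
      simp only [hcast, hS0, poissonWeight_zero_right, h]
  · rw [hlast]
    linarith [poissonCum_pos hd (hS t ht).1]
  · obtain ⟨h0, hD⟩ := hS t ht
    refine HasDerivAt.hasDerivWithinAt ?_
    have hne : poissonCum (e + 1) (S t) ≠ 0 := (poissonCum_pos hd h0).ne'
    refine Fin.lastCases ?_ (fun j => ?_) k
    · simp only [hlast]
      refine (((hasDerivAt_poissonCum_succ e (S t)).comp t hD).const_sub 1).congr_deriv ?_
      have h1 : (Fin.last (e + 1) - 1 : Fin (e + 1 + 1)) = (Fin.last e).castSucc := by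
        ext
        rw [Fin.coe_sub_one]
        simp [Fin.ext_iff]
      rw [drift, if_pos (by simp [Fin.lt_def]), if_neg (lt_irrefl _), h1, hlast, hcast, sub_sub_cancel]
      simp only [Fin.val_last]
      field_simp
      ring
    · simp only [hcast]
      obtain ⟨j, hj⟩ := j
      rcases j with _ | j
      · refine ((hasDerivAt_poissonWeight_zero (S t)).comp t hD).congr_deriv ?_
        rw [drift, if_neg (by simp), if_pos (Fin.castSucc_lt_last _), hlast, hcast,
          sub_sub_cancel]
        field_simp
        ring
      · refine ((hasDerivAt_poissonWeight_succ j (S t)).comp t hD).congr_deriv ?_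
        have h1 : ((⟨j + 1, hj⟩ : Fin (e + 1)).castSucc - 1 : Fin (e + 1 + 1))
            = (⟨j, by omega⟩ : Fin (e + 1)).castSucc := by
          ext
          rw [Fin.coe_sub_one]
          simp [Fin.ext_iff]
        rw [drift, if_pos (by simp [Fin.lt_def]), if_pos (Fin.castSucc_lt_last _), h1, hlast,
          hcast, hcast, sub_sub_cancel]
        field_simp

end Existence

end DProc

end

theorem theorem4 (d : ℕ) (hd : 0 < d) :
    (∃ γ : ℝ → EuclideanSpace ℝ (Fin (d + 1)), DProc.IsSolution d γ) ∧
    ∀ γ : ℝ → EuclideanSpace ℝ (Fin (d + 1)), DProc.IsSolution d γ →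
      ∃ S : ℝ → Matrix (Fin (d + 1)) (Fin (d + 1)) ℝ,
        ContinuousOn S (Set.Ico (0 : ℝ) (d / 2)) ∧
        (∀ t ∈ Set.Ico (0 : ℝ) (d / 2), (S t).PosSemidef) ∧
        ∀ δ : ℝ, 0 < δ →
          ∀ f : EuclideanSpace ℝ (Fin (d + 1)) →ᵇ ℝ, ∀ ε : ℝ, 0 < ε →
            ∀ᶠ n : ℕ in atTop, ∀ m : ℕ, m ≤ DProc.mDelta d γ δ n →
              |(∫ x, f x ∂(DProc.normalizedLaw d γ n m)) -
                ∫ x, f x ∂(multivariateGaussian 0 (S ((m : ℝ) / n)))| < ε := by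
  refine ⟨DProc.exists_isSolution hd, fun γ hγ =>
    ⟨fun t => DProc.covMatrix (γ t), DProc.continuousOn_covMatrix hγ,
      fun t ht => DProc.posSemidef_covMatrix hγ ht, fun δ hδ f ε hε => ?_⟩⟩
  obtain ⟨T, hT0, hT, hmT⟩ := DProc.exists_mDelta_le hγ hd hδ
  filter_upwards [hmT, DProc.eventually_abs_integral_sub_lt hγ hd hT0 hT f hε] with n hn h m hm
  exact h m ((Nat.cast_le.2 hm).trans hn)
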